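/- Let $\Bbbk$ be an algebraically closed field of characteristic zero and let $\xi\in\Bbbk$ be a primitive fourth root of unity. Let $\mathcal K$ be the Hopf algebra generated as an algebra by $a,b,c,d$ with relations $$ab=\xi ba,\quad ac=\xi ca,\quad cb=bc=0,\quad cd=\xi dc,\quad bd=\xi db,\quad ad=da=1,\quad b^2=c^2=0,\quad a^2c=b,\quad a^4=1,$$ with comultiplication $$\Delta(a)=a\otimes a+b\otimes c,\quad \Delta(b)=a\otimes b+b\otimes d,\quad \Delta(c)=c\otimes a+d\otimes c,\quad \Delta(d)=c\otimes b+d\otimes d,$$ counit $\varepsilon(a)=\varepsilon(d)=1$, $\varepsilon(b)=\varepsilon(c)=0$, and antipode $\mathcal S(a)=d$, $\mathcal S(b)=\xi b$, $\mathcal S(c)=-\xi c$, $\mathcal S(d)=a$. Let $V_{3,1}$ be the left Yetter–Drinfeld module over $\mathcal K$ with basis $e_1,e_2$, action $$a\cdot e_1=-\xi e_1,\quad a\cdot e_2=-e_2,\quad b\cdot e_1=c\cdot e_1=0,\quad b\cdot e_2=-e_1,\quad c\cdot e_2=e_1,\quad d\cdot e_1=\xi e_1,\quad d\cdot e_2=-e_2,$$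 and coaction $$\delta(e_1)=d\otimes e_1+(\xi-1)\,c\otimes e_2,\qquad \delta(e_2)=a\otimes e_2-\tfrac12(1+\xi)\,b\otimes e_1 .$$ For a Yetter–Drinfeld module $V$, the Nichols algebra $\mathfrak B(V)$ is the quotient of the tensor algebra $T(V)$ by its largest two-sided ideal $I$ which is generated by homogeneous elements of degree at least $2$ and satisfies $\Delta(I)\subseteq I\otimes T(V)+T(V)\otimes I$. Here $\Delta$ is the algebra map from $T(V)$ to the braided tensor product $T(V)\otimes T(V)$ with $\Delta(v)=v\otimes 1+1\otimes v$ for $v\in V$, where the product of $T(V)\otimes T(V)$ is $(x\otimes y)(z\otimes w)=x\,(y_{(-1)}\cdot z)\otimes y_{(0)}w$. **Proposition.** The Nichols algebra $\mathfrak B(V_{3,1})$ is the algebra generated by $x,y$ subject to the relations $$x^2-2y^2=0,\qquad xy+yx=0,\qquad y^4=0,$$ that is, there is an isomorphism from the algebra so presented onto $\mathfrak B(V_{3,1})$ which sends $x$ and $y$ to the classes of $e_1$ and $e_2$. In particular, $\dim_{\Bbbk}\mathfrak B(V_{3,1})=8$. -/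

import Mathlib

open scoped TensorProduct

noncomputable section

universe u v w

/-! ### Left Yetter-Drinfeld modules over a Hopf algebra -/

section YetterDrinfeld

variable (k : Type u) [Field k] (H : Type v) [Ring H] [HopfAlgebra k H]

/-- For `p, q, r` in `H` and an action `ρ` of `H` on `V`, the operator
`g ⊗ m ↦ p g S(r) ⊗ q · m` on `H ⊗ V`, as a linear function of `p ⊗ (q ⊗ r)`. -/
def ydOperator {V : Type w} [AddCommGroup V] [Module k V] (ρ : H →ₐ[k] Module.End k V) :
    H ⊗[k] (H ⊗[k] H) →ₗ[k] (H ⊗[k] V →ₗ[k] H ⊗[k] V) :=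
  TensorProduct.lift <| LinearMap.mk₂ k
    (fun p t => TensorProduct.lift
      (LinearMap.mk₂ k
        (fun q r => TensorProduct.map
          (LinearMap.mulLeft k p ∘ₗ LinearMap.mulRight k (HopfAlgebra.antipode k r)) (ρ q))
        (fun q q' r => by rw [map_add, TensorProduct.map_add_right])
        (fun s q r => by rw [map_smul, TensorProduct.map_smul_right])
        (fun q r r' => by
          rw [map_add, ← TensorProduct.map_add_left]
          congr 1; ext; simp [mul_add])
        (fun s q r => by
          rw [map_smul, ← TensorProduct.map_smul_left]
          congr 1; ext; simp)) t)
    (fun p p' t => by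
      induction t using TensorProduct.induction_on with
      | zero => simp
      | tmul q r => ext; simp [add_mul, TensorProduct.add_tmul]
      | add t t' h h' => simp only [map_add, h, h']; abel)
    (fun s p t => by
      induction t using TensorProduct.induction_on with
      | zero => simp
      | tmul q r => ext; simp [TensorProduct.smul_tmul']
      | add t t' h h' => simp only [map_add, h, h', smul_add])
    (fun p t t' => by simp)
    (fun s p t => by simp)

theorem ydOperator_apply {V : Type w} [AddCommGroup V] [Module k V] (ρ : H →ₐ[k] Module.End k V)
    (p q r g : H) (m : V) :
    ydOperator k H ρ (p ⊗ₜ (q ⊗ₜ r)) (g ⊗ₜ m) =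
      (p * (g * HopfAlgebra.antipode k r)) ⊗ₜ ρ q m := by
  simp [ydOperator]

/-- For `h : H` the operator `g ⊗ m ↦ h₍₁₎ g S(h₍₃₎) ⊗ h₍₂₎ · m` on `H ⊗ V`. -/
def ydTwist {V : Type w} [AddCommGroup V] [Module k V] (ρ : H →ₐ[k] Module.End k V) :
    H →ₗ[k] (H ⊗[k] V →ₗ[k] H ⊗[k] V) :=
  ydOperator k H ρ ∘ₗ (Coalgebra.comul (R := k) (A := H)).lTensor H ∘ₗ
    Coalgebra.comul (R := k) (A := H)

theorem ydTwist_mul {V : Type w} [AddCommGroup V] [Module k V]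
    (ρ : H →ₐ[k] Module.End k V) (x y : H) (t : H ⊗[k] V) :
    ydTwist k H ρ (x * y) t = ydTwist k H ρ x (ydTwist k H ρ y t) := by
  have key : ∀ (z z' : H ⊗[k] (H ⊗[k] H)) (t : H ⊗[k] V),
      ydOperator k H ρ (z * z') t = ydOperator k H ρ z (ydOperator k H ρ z' t) := by
    have key₀ : ∀ (p q r p' q' r' g : H) (m : V),
        ydOperator k H ρ ((p ⊗ₜ (q ⊗ₜ r)) * (p' ⊗ₜ (q' ⊗ₜ r'))) (g ⊗ₜ m) =
          ydOperator k H ρ (p ⊗ₜ (q ⊗ₜ r)) (ydOperator k H ρ (p' ⊗ₜ (q' ⊗ₜ r')) (g ⊗ₜ m)) := by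
      intros
      simp [ydOperator_apply, HopfAlgebra.antipode_mul_antidistrib, mul_assoc]
    intro z z' t
    induction t using TensorProduct.induction_on with
    | zero => simp
    | add t t' h h' => simp only [map_add, h, h']
    | tmul g m =>
      induction z using TensorProduct.induction_on with
      | zero => simp
      | add z w h h' => simp only [add_mul, map_add, LinearMap.add_apply, h, h']
      | tmul p u =>
        induction u using TensorProduct.induction_on with
        | zero => simp
        | add u w h h' =>
          simp only [TensorProduct.tmul_add, add_mul, map_add, LinearMap.add_apply, h, h']
        | tmul q r =>
          induction z' using TensorProduct.induction_on with
          | zero => simp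
          | add z' w h h' => simp only [mul_add, map_add, LinearMap.add_apply, h, h']
          | tmul p' u =>
            induction u using TensorProduct.induction_on with
            | zero => simp
            | add u w h h' =>
              simp only [TensorProduct.tmul_add, mul_add, map_add, LinearMap.add_apply, h, h']
            | tmul q' r' => exact key₀ p q r p' q' r' g m
  have hΔ : ∀ x y : H ⊗[k] H, (Coalgebra.comul (R := k) (A := H)).lTensor H (x * y) =
      (Coalgebra.comul (R := k) (A := H)).lTensor H x *
        (Coalgebra.comul (R := k) (A := H)).lTensor H y := fun x y =>
    map_mul (Algebra.TensorProduct.map (AlgHom.id k H) (Bialgebra.comulAlgHom k H)) x y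
  simp only [ydTwist, LinearMap.comp_apply, Bialgebra.comul_mul, hΔ, key]

theorem ydTwist_algebraMap {V : Type w} [AddCommGroup V] [Module k V]
    (ρ : H →ₐ[k] Module.End k V) (r : k) (t : H ⊗[k] V) :
    ydTwist k H ρ (algebraMap k H r) t = r • t := by
  rw [Algebra.algebraMap_eq_smul_one, map_smul, LinearMap.smul_apply]
  congr 1
  induction t using TensorProduct.induction_on with
  | zero => simp
  | add t t' h h' => simp only [map_add, h, h']
  | tmul g m => simp [ydTwist, Algebra.TensorProduct.one_def, ydOperator_apply]

/-- A left Yetter-Drinfeld module structure over the Hopf algebra `H` on the vector space `V`: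
a left action, a left coaction, and the compatibility
`δ(h · m) = h₍₁₎ m₍₋₁₎ S(h₍₃₎) ⊗ h₍₂₎ · m₍₀₎`. -/
structure YetterDrinfeldModule (V : Type w) [AddCommGroup V] [Module k V] where
  /-- the left action -/
  act : H →ₐ[k] Module.End k V
  /-- the left coaction `m ↦ m₍₋₁₎ ⊗ m₍₀₎` -/
  coact : V →ₗ[k] H ⊗[k] V
  coassoc : ∀ m : V,
    TensorProduct.assoc k H H V ((Coalgebra.comul (R := k) (A := H)).rTensor V (coact m)) =
      coact.lTensor H (coact m)
  counit_coact : ∀ m : V,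
    TensorProduct.lid k V ((Coalgebra.counit (R := k) (A := H)).rTensor V (coact m)) = m
  compat : ∀ (h : H) (m : V), coact (act h m) = ydTwist k H act h (coact m)

end YetterDrinfeld

/-! ### The Nichols algebra of a Yetter-Drinfeld module -/

namespace YetterDrinfeldModule

variable {k : Type u} [Field k] {H : Type v} [Ring H] [HopfAlgebra k H]
  {V : Type w} [AddCommGroup V] [Module k V] (M : YetterDrinfeldModule k H V)

/-- The diagonal action of `H` on `T(V)`:
`h · (v₁ ⋯ vₙ) = (h₍₁₎ · v₁) ⋯ (h₍ₙ₎ · vₙ)` and `h · 1 = ε(h) 1`. It is written through the algebra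
map from `T(V)` to the convolution algebra of linear maps `H → T(V)` which extends
`v ↦ (h ↦ h · v)`. -/
def tensorAct : H →ₗ[k] TensorAlgebra k V →ₗ[k] TensorAlgebra k V :=
  LinearMap.flip
    ((WithConv.linearEquiv k (H →ₗ[k] TensorAlgebra k V)).toLinearMap ∘ₗ
      (TensorAlgebra.lift k
        ((WithConv.linearEquiv k (H →ₗ[k] TensorAlgebra k V)).symm.toLinearMap ∘ₗ
          ((LinearMap.llcomp k H V (TensorAlgebra k V) (TensorAlgebra.ι k)) ∘ₗ
            M.act.toLinearMap.flip))).toLinearMap)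

/-- The codiagonal coaction of `H` on `T(V)`: the algebra map `T(V) → H ⊗ T(V)` which extends the
coaction of `V`. -/
def tensorCoact : TensorAlgebra k V →ₐ[k] H ⊗[k] TensorAlgebra k V :=
  TensorAlgebra.lift k ((TensorAlgebra.ι k).lTensor H ∘ₗ M.coact)

/-- The braiding `c(x ⊗ y) = x₍₋₁₎ · y ⊗ x₍₀₎` of `T(V)` with itself. -/
def tensorBraiding :
    TensorAlgebra k V ⊗[k] TensorAlgebra k V →ₗ[k] TensorAlgebra k V ⊗[k] TensorAlgebra k V :=
  (TensorProduct.lift M.tensorAct).rTensor (TensorAlgebra k V) ∘ₗ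
    (TensorProduct.assoc k H (TensorAlgebra k V) (TensorAlgebra k V)).symm.toLinearMap ∘ₗ
    (TensorProduct.comm k (TensorAlgebra k V) (TensorAlgebra k V)).toLinearMap.lTensor H ∘ₗ
    (TensorProduct.assoc k H (TensorAlgebra k V) (TensorAlgebra k V)).toLinearMap ∘ₗ
    M.tensorCoact.toLinearMap.rTensor (TensorAlgebra k V)

/-- Multiplication of the braided tensor product `T(V) ⊗ T(V)`, that is
`(x ⊗ y) (z ⊗ w) = x c(y ⊗ z) w = x (y₍₋₁₎ · z) ⊗ y₍₀₎ w`. -/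
def braidedMul :
    (TensorAlgebra k V ⊗[k] TensorAlgebra k V) →ₗ[k]
      (TensorAlgebra k V ⊗[k] TensorAlgebra k V) →ₗ[k]
        (TensorAlgebra k V ⊗[k] TensorAlgebra k V) :=
  TensorProduct.curry
    (TensorProduct.map (LinearMap.mul' k (TensorAlgebra k V)) (LinearMap.mul' k (TensorAlgebra k V))
      ∘ₗ (TensorProduct.assoc k (TensorAlgebra k V) (TensorAlgebra k V)
          (TensorAlgebra k V ⊗[k] TensorAlgebra k V)).symm.toLinearMap
      ∘ₗ (TensorProduct.assoc k (TensorAlgebra k V) (TensorAlgebra k V)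
          (TensorAlgebra k V)).toLinearMap.lTensor (TensorAlgebra k V)
      ∘ₗ (M.tensorBraiding.rTensor (TensorAlgebra k V)).lTensor (TensorAlgebra k V)
      ∘ₗ (TensorProduct.assoc k (TensorAlgebra k V) (TensorAlgebra k V)
          (TensorAlgebra k V)).symm.toLinearMap.lTensor (TensorAlgebra k V)
      ∘ₗ (TensorProduct.assoc k (TensorAlgebra k V) (TensorAlgebra k V)
          (TensorAlgebra k V ⊗[k] TensorAlgebra k V)).toLinearMap)

/-- The comultiplication of the braided Hopf algebra `T(V)`: the algebra map to the braided tensor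
product with `Δ(v) = v ⊗ 1 + 1 ⊗ v` for `v` in `V`. It is written as
`Δ(v₁ v₂ ⋯ vₙ) = Δ(v₁) (Δ(v₂) ( ⋯ (Δ(vₙ) (1 ⊗ 1))))`, all products being those of the braided
tensor product. -/
def tensorComul : TensorAlgebra k V →ₗ[k] TensorAlgebra k V ⊗[k] TensorAlgebra k V :=
  LinearMap.applyₗ (1 ⊗ₜ[k] 1 : TensorAlgebra k V ⊗[k] TensorAlgebra k V) ∘ₗ
    (TensorAlgebra.lift k (A := Module.End k (TensorAlgebra k V ⊗[k] TensorAlgebra k V))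
      (M.braidedMul ∘ₗ
        ((TensorProduct.mk k (TensorAlgebra k V) (TensorAlgebra k V)).flip 1 ∘ₗ TensorAlgebra.ι k +
          TensorProduct.mk k (TensorAlgebra k V) (TensorAlgebra k V) 1 ∘ₗ
            TensorAlgebra.ι k))).toLinearMap

/-- The set of all two-sided ideals `I` of `T(V)` which are generated by homogeneous elements of
degree at least `2` (so that they are homogeneous) and satisfy `Δ(I) ⊆ I ⊗ T(V) + T(V) ⊗ I`. -/
def nicholsIdeals : Set (TwoSidedIdeal (TensorAlgebra k V)) :=
  {I | (∃ S : Set (TensorAlgebra k V),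
          (∀ s ∈ S, ∃ n : ℕ, 2 ≤ n ∧ s ∈ LinearMap.range (TensorAlgebra.ι k (M := V)) ^ n) ∧
          I = TwoSidedIdeal.span S) ∧
        ∀ t ∈ I, M.tensorComul t ∈
          Submodule.span k {z | ∃ x ∈ I, ∃ y : TensorAlgebra k V, z = x ⊗ₜ[k] y ∨ z = y ⊗ₜ[k] x}}

/-- The largest element of `nicholsIdeals`, see `nicholsIdeal_isGreatest`. -/
def nicholsIdeal : TwoSidedIdeal (TensorAlgebra k V) :=
  TwoSidedIdeal.span {t | ∃ I ∈ M.nicholsIdeals, t ∈ I}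

theorem nicholsIdeal_isGreatest : IsGreatest M.nicholsIdeals M.nicholsIdeal := by
  have hle : ∀ I ∈ M.nicholsIdeals, I ≤ M.nicholsIdeal := by
    intro I hI t ht
    exact TwoSidedIdeal.subset_span (Set.mem_ofPred.2 ⟨I, hI, ht⟩)
  refine ⟨⟨⟨{s | (∃ n : ℕ, 2 ≤ n ∧ s ∈ LinearMap.range (TensorAlgebra.ι k (M := V)) ^ n) ∧
      s ∈ M.nicholsIdeal}, fun s hs => hs.1, le_antisymm ?_ ?_⟩, ?_⟩, hle⟩
  · refine TwoSidedIdeal.span_le.2 ?_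
    rintro t ⟨I, hI, ht⟩
    obtain ⟨⟨S, hS, rfl⟩, -⟩ := id hI
    refine TwoSidedIdeal.span_mono ?_ ht
    intro s hs
    exact Set.mem_ofPred.2 ⟨hS s hs, hle _ hI (TwoSidedIdeal.subset_span hs)⟩
  · exact TwoSidedIdeal.span_le.2 fun s hs => hs.2
  · intro t ht
    rw [nicholsIdeal, TwoSidedIdeal.mem_span_iff_mem_addSubgroup_closure_absorbing] at ht
    · induction ht using AddSubgroup.closure_induction with
      | mem x hx =>
        obtain ⟨I, hI, hx⟩ := hx
        refine Submodule.span_mono ?_ (hI.2 x hx)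
        rintro z ⟨x, hx, y, h⟩
        exact ⟨x, hle I hI hx, y, h⟩
      | zero => simp
      | add x y hx hy h h' => rw [map_add]; exact Submodule.add_mem _ h h'
      | neg x hx h => rw [map_neg]; exact Submodule.neg_mem _ h
    · rintro x y ⟨I, hI, hy⟩
      exact ⟨I, hI, I.mul_mem_left _ _ hy⟩
    · rintro y x ⟨I, hI, hy⟩
      exact ⟨I, hI, I.mul_mem_right _ _ hy⟩

/-- The Nichols algebra `𝔅(V)`, the quotient of `T(V)` by its largest two-sided ideal which is
generated by homogeneous elements of degree at least `2` and is a coideal. -/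
abbrev NicholsAlgebra : Type _ := M.nicholsIdeal.ringCon.Quotient

/-- The canonical map `V → 𝔅(V)`. -/
def nicholsι (v : V) : M.NicholsAlgebra :=
  M.nicholsIdeal.ringCon.mk' (TensorAlgebra.ι k v)

end YetterDrinfeldModule

/-! ### The Hopf algebra `𝒦` -/

section HopfK

variable {k : Type u} [Field k]

/-- The four algebra generators of `𝒦`. -/
inductive KGen
  | a | b | c | d

open KGen in
/-- The defining relations of `𝒦`. -/
inductive KRel (ξ : k) : FreeAlgebra k KGen → FreeAlgebra k KGen → Prop
  | ab : KRel ξ (FreeAlgebra.ι k a * FreeAlgebra.ι k b) (ξ • (FreeAlgebra.ι k b * FreeAlgebra.ι k a))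
  | ac : KRel ξ (FreeAlgebra.ι k a * FreeAlgebra.ι k c) (ξ • (FreeAlgebra.ι k c * FreeAlgebra.ι k a))
  | cb : KRel ξ (FreeAlgebra.ι k c * FreeAlgebra.ι k b) 0
  | bc : KRel ξ (FreeAlgebra.ι k b * FreeAlgebra.ι k c) 0
  | cd : KRel ξ (FreeAlgebra.ι k c * FreeAlgebra.ι k d) (ξ • (FreeAlgebra.ι k d * FreeAlgebra.ι k c))
  | bd : KRel ξ (FreeAlgebra.ι k b * FreeAlgebra.ι k d) (ξ • (FreeAlgebra.ι k d * FreeAlgebra.ι k b))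
  | ad_comm : KRel ξ (FreeAlgebra.ι k a * FreeAlgebra.ι k d) (FreeAlgebra.ι k d * FreeAlgebra.ι k a)
  | ad : KRel ξ (FreeAlgebra.ι k a * FreeAlgebra.ι k d) 1
  | bb : KRel ξ (FreeAlgebra.ι k b ^ 2) 0
  | cc : KRel ξ (FreeAlgebra.ι k c ^ 2) 0
  | aac : KRel ξ (FreeAlgebra.ι k a ^ 2 * FreeAlgebra.ι k c) (FreeAlgebra.ι k b)
  | aaaa : KRel ξ (FreeAlgebra.ι k a ^ 4) 1

/-- The algebra `𝒦`, presented by generators and relations; `ξ` is a primitive fourth root of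
unity. -/
def HopfK {ξ : k} (_hξ : IsPrimitiveRoot ξ 4) : Type u := RingQuot (KRel ξ)

namespace HopfK

variable {ξ : k} (hξ : IsPrimitiveRoot ξ 4)

instance : Ring (HopfK hξ) := inferInstanceAs (Ring (RingQuot (KRel ξ)))
instance : Algebra k (HopfK hξ) := inferInstanceAs (Algebra k (RingQuot (KRel ξ)))

/-- The quotient map from the free algebra. -/
def mk : FreeAlgebra k KGen →ₐ[k] HopfK hξ := RingQuot.mkAlgHom k (KRel ξ)

/-- The image in `𝒦` of a generator. -/
def gen (i : KGen) : HopfK hξ := mk hξ (FreeAlgebra.ι k i)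

/-- The algebra map out of `𝒦` with given values on the generators. -/
def lift {A : Type*} [Ring A] [Algebra k A] (f : KGen → A)
    (hf : ∀ ⦃s t⦄, KRel ξ s t → FreeAlgebra.lift k f s = FreeAlgebra.lift k f t) :
    HopfK hξ →ₐ[k] A :=
  RingQuot.liftAlgHom k ⟨FreeAlgebra.lift k f, hf⟩

theorem lift_gen {A : Type*} [Ring A] [Algebra k A] (f : KGen → A)
    (hf : ∀ ⦃s t⦄, KRel ξ s t → FreeAlgebra.lift k f s = FreeAlgebra.lift k f t) (i : KGen) :
    lift hξ f hf (gen hξ i) = f i := by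
  have h : lift hξ f hf (gen hξ i) = FreeAlgebra.lift k f (FreeAlgebra.ι k i) :=
    RingQuot.liftAlgHom_mkAlgHom_apply k (FreeAlgebra.lift k f) hf (FreeAlgebra.ι k i)
  rw [h, FreeAlgebra.lift_ι_apply]

theorem algHom_ext {A : Type*} [Ring A] [Algebra k A] {f g : HopfK hξ →ₐ[k] A}
    (h : ∀ i, f (gen hξ i) = g (gen hξ i)) : f = g :=
  RingQuot.ringQuot_ext' k f g (FreeAlgebra.hom_ext (funext h))

theorem induction {P : HopfK hξ → Prop} (hgen : ∀ i, P (gen hξ i))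
    (hscalar : ∀ r : k, P (algebraMap k _ r)) (hmul : ∀ x y, P x → P y → P (x * y))
    (hadd : ∀ x y, P x → P y → P (x + y)) (x : HopfK hξ) : P x := by
  obtain ⟨y, rfl⟩ := RingQuot.mkAlgHom_surjective k (KRel ξ) x
  induction y using FreeAlgebra.induction with
  | grade0 r => rw [AlgHom.commutes]; exact hscalar r
  | grade1 i => exact hgen i
  | mul x y hx hy => rw [map_mul]; exact hmul _ _ hx hy
  | add x y hx hy => rw [map_add]; exact hadd _ _ hx hy

theorem xi_sq {ξ : k} (hξ : IsPrimitiveRoot ξ 4) : ξ ^ 2 = -1 := by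
  have h : (ξ ^ 2 - 1) * (ξ ^ 2 + 1) = 0 := by linear_combination hξ.pow_eq_one
  rcases mul_eq_zero.1 h with h | h
  · exact absurd (sub_eq_zero.1 h) (hξ.pow_ne_one_of_pos_of_lt (by norm_num) (by norm_num))
  · linear_combination h

theorem xi_ne_zero {ξ : k} (hξ : IsPrimitiveRoot ξ 4) : ξ ≠ 0 := hξ.ne_zero (by norm_num)

/-! All elements are rewritten as combinations of `aⁱ cʲ`. -/

theorem gen_rel {s t : FreeAlgebra k KGen} (h : KRel ξ s t) : mk hξ s = mk hξ t :=
  RingQuot.mkAlgHom_rel k h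

theorem mk_ι (i : KGen) : mk hξ (FreeAlgebra.ι k i) = gen hξ i := rfl

theorem gen_aaaa : gen hξ .a * (gen hξ .a * (gen hξ .a * gen hξ .a)) = 1 := by
  have h := gen_rel hξ KRel.aaaa
  simpa only [map_one, pow_succ, pow_zero, one_mul, mul_assoc, map_mul, mk_ι] using h

theorem gen_d : gen hξ .d = gen hξ .a * (gen hξ .a * gen hξ .a) := by
  have h := gen_rel hξ KRel.ad
  rw [map_mul, map_one, mk_ι, mk_ι] at h
  calc gen hξ .d = gen hξ .a * (gen hξ .a * (gen hξ .a * gen hξ .a)) * gen hξ .d := by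
        rw [gen_aaaa, one_mul]
    _ = gen hξ .a * (gen hξ .a * (gen hξ .a * (gen hξ .a * gen hξ .d))) := by
        simp only [mul_assoc]
    _ = _ := by rw [h, mul_one]

theorem gen_b : gen hξ .b = gen hξ .a * (gen hξ .a * gen hξ .c) := by
  have h := gen_rel hξ KRel.aac
  simp only [map_mul, pow_two, mul_assoc, mk_ι] at h
  exact h.symm

theorem gen_cc : gen hξ .c * gen hξ .c = 0 := by
  have h := gen_rel hξ KRel.cc
  simp only [map_mul, pow_two, map_zero, mk_ι] at h
  exact h

theorem gen_ca : gen hξ .c * gen hξ .a = (-ξ) • (gen hξ .a * gen hξ .c) := by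
  have h := gen_rel hξ KRel.ac
  simp only [map_mul, map_smul, mk_ι] at h
  rw [h, smul_smul, show -ξ * ξ = 1 by linear_combination -xi_sq hξ, one_smul]

theorem gen_aaaa_mul (x : HopfK hξ) :
    gen hξ .a * (gen hξ .a * (gen hξ .a * (gen hξ .a * x))) = x := by
  have h := congrArg (· * x) (gen_aaaa hξ)
  simpa only [mul_assoc, one_mul] using h

theorem gen_cc_mul (x : HopfK hξ) : gen hξ .c * (gen hξ .c * x) = 0 := by
  rw [← mul_assoc, gen_cc, zero_mul]

theorem gen_ca_mul (x : HopfK hξ) :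
    gen hξ .c * (gen hξ .a * x) = (-ξ) • (gen hξ .a * (gen hξ .c * x)) := by
  rw [← mul_assoc, gen_ca, smul_mul_assoc, mul_assoc]

/-- Values of the comultiplication on the generators. -/
def comulGen : KGen → HopfK hξ ⊗[k] HopfK hξ
  | .a => gen hξ .a ⊗ₜ gen hξ .a + gen hξ .b ⊗ₜ gen hξ .c
  | .b => gen hξ .a ⊗ₜ gen hξ .b + gen hξ .b ⊗ₜ gen hξ .d
  | .c => gen hξ .c ⊗ₜ gen hξ .a + gen hξ .d ⊗ₜ gen hξ .c
  | .d => gen hξ .c ⊗ₜ gen hξ .b + gen hξ .d ⊗ₜ gen hξ .d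

/-- Values of the counit on the generators. -/
def counitGen : KGen → k
  | .a => 1
  | .b => 0
  | .c => 0
  | .d => 1

/-- Values of the antipode on the generators. -/
def antipodeGen : KGen → (HopfK hξ)ᵐᵒᵖ
  | .a => .op (gen hξ .d)
  | .b => .op (ξ • gen hξ .b)
  | .c => .op (-ξ • gen hξ .c)
  | .d => .op (gen hξ .a)

/-- The comultiplication as an algebra map. -/
def comulHom : HopfK hξ →ₐ[k] HopfK hξ ⊗[k] HopfK hξ :=
  lift hξ (comulGen hξ) (by
    have h2 := xi_sq hξ
    intro s t h
    induction h <;>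
      simp [comulGen, gen_b, gen_d, pow_succ, mul_add, add_mul,
        Algebra.TensorProduct.tmul_mul_tmul, mul_assoc, gen_aaaa, gen_cc, gen_ca, gen_aaaa_mul,
        gen_ca_mul, ← TensorProduct.smul_tmul', TensorProduct.neg_tmul, TensorProduct.tmul_neg,
        TensorProduct.tmul_smul, smul_smul,
        Algebra.TensorProduct.one_def] <;>
      match_scalars <;> grind)

/-- The counit as an algebra map. -/
def counitHom : HopfK hξ →ₐ[k] k :=
  lift hξ counitGen (by
    intro s t h
    induction h <;> simp [counitGen])

/-- The antipode as an algebra map to the opposite algebra. -/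
def antipodeHom : HopfK hξ →ₐ[k] (HopfK hξ)ᵐᵒᵖ :=
  lift hξ (antipodeGen hξ) (by
    have h2 := xi_sq hξ
    intro s t h
    induction h <;> apply MulOpposite.unop_injective <;>
      simp [antipodeGen, gen_b, gen_d, pow_succ, mul_assoc, gen_aaaa, gen_cc, gen_ca,
        gen_aaaa_mul, smul_smul] <;>
      match_scalars <;> grind)

theorem comulHom_gen (i : KGen) : comulHom hξ (gen hξ i) = comulGen hξ i := lift_gen _ _ _ _

theorem counitHom_gen (i : KGen) : counitHom hξ (gen hξ i) = counitGen i := lift_gen _ _ _ _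

theorem antipodeHom_gen (i : KGen) : antipodeHom hξ (gen hξ i) = antipodeGen hξ i :=
  lift_gen _ _ _ _

instance : Bialgebra k (HopfK hξ) :=
  Bialgebra.ofAlgHom (comulHom hξ) (counitHom hξ)
    (algHom_ext hξ fun i => by
      cases i <;>
        simp [comulHom_gen, comulGen, TensorProduct.add_tmul, TensorProduct.tmul_add] <;> abel)
    (algHom_ext hξ fun i => by
      cases i <;> simp [comulHom_gen, comulGen, counitHom_gen, counitGen])
    (algHom_ext hξ fun i => by
      cases i <;> simp [comulHom_gen, comulGen, counitHom_gen, counitGen])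

theorem comul_gen (i : KGen) : Coalgebra.comul (R := k) (gen hξ i) = comulGen hξ i :=
  comulHom_gen hξ i

theorem counit_gen (i : KGen) : Coalgebra.counit (R := k) (gen hξ i) = counitGen i :=
  counitHom_gen hξ i

/-- The antipode as a linear map. -/
def antipodeLin : HopfK hξ →ₗ[k] HopfK hξ :=
  (MulOpposite.opLinearEquiv k).symm.toLinearMap ∘ₗ (antipodeHom hξ).toLinearMap

theorem antipodeLin_gen (i : KGen) : antipodeLin hξ (gen hξ i) = (antipodeGen hξ i).unop :=
  congrArg MulOpposite.unop (antipodeHom_gen hξ i)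

theorem antipodeLin_mul (x y : HopfK hξ) :
    antipodeLin hξ (x * y) = antipodeLin hξ y * antipodeLin hξ x := by
  simp [antipodeLin]

theorem antipodeLin_algebraMap (r : k) :
    antipodeLin hξ (algebraMap k _ r) = algebraMap k _ r := by
  simp [antipodeLin]

theorem antipodeLin_one : antipodeLin hξ 1 = 1 := by
  simp [antipodeLin]

theorem antipode_left_aux (z : HopfK hξ ⊗[k] HopfK hξ) (r : k)
    (h : LinearMap.mul' k _ ((antipodeLin hξ).rTensor _ z) = algebraMap k _ r)
    (w : HopfK hξ ⊗[k] HopfK hξ) :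
    LinearMap.mul' k _ ((antipodeLin hξ).rTensor _ (z * w)) =
      r • LinearMap.mul' k _ ((antipodeLin hξ).rTensor _ w) := by
  induction w using TensorProduct.induction_on with
  | zero => simp
  | tmul p q =>
    have key : LinearMap.mul' k _ ((antipodeLin hξ).rTensor _ (z * p ⊗ₜ[k] q)) =
        antipodeLin hξ p * LinearMap.mul' k _ ((antipodeLin hξ).rTensor _ z) * q := by
      clear h
      induction z using TensorProduct.induction_on with
      | zero => simp
      | tmul s t => simp [antipodeLin_mul, mul_assoc]
      | add z z' h h' => simp only [add_mul, map_add, mul_add, h, h']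
    rw [key, h, ← Algebra.commutes, mul_assoc, ← Algebra.smul_def]
    simp
  | add w w' h h' => simp only [mul_add, map_add, smul_add, h, h']

theorem antipode_right_aux (w : HopfK hξ ⊗[k] HopfK hξ) (r : k)
    (h : LinearMap.mul' k _ ((antipodeLin hξ).lTensor _ w) = algebraMap k _ r)
    (z : HopfK hξ ⊗[k] HopfK hξ) :
    LinearMap.mul' k _ ((antipodeLin hξ).lTensor _ (z * w)) =
      r • LinearMap.mul' k _ ((antipodeLin hξ).lTensor _ z) := by
  induction z using TensorProduct.induction_on with
  | zero => simp
  | tmul p q =>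
    have key : LinearMap.mul' k _ ((antipodeLin hξ).lTensor _ (p ⊗ₜ[k] q * w)) =
        p * LinearMap.mul' k _ ((antipodeLin hξ).lTensor _ w) * antipodeLin hξ q := by
      clear h
      induction w using TensorProduct.induction_on with
      | zero => simp
      | tmul s t => simp [antipodeLin_mul, mul_assoc]
      | add z z' h h' => simp only [add_mul, map_add, mul_add, h, h']
    rw [key, h, ← Algebra.commutes, mul_assoc, ← Algebra.smul_def]
    simp
  | add w w' h h' => simp only [add_mul, map_add, smul_add, h, h']

theorem antipode_left (x : HopfK hξ) :
    LinearMap.mul' k _ ((antipodeLin hξ).rTensor _ (Coalgebra.comul (R := k) x)) =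
      algebraMap k _ (Coalgebra.counit (R := k) x) := by
  have h2 := xi_sq hξ
  induction x using HopfK.induction with
  | hgen i =>
    rw [comul_gen, counit_gen]
    cases i <;>
      simp only [comulGen, counitGen, map_add, LinearMap.rTensor_tmul, LinearMap.mul'_apply,
        antipodeLin_gen, antipodeGen, MulOpposite.unop_op] <;>
      simp [gen_b, gen_d, mul_assoc, gen_aaaa, gen_cc, gen_ca, gen_aaaa_mul, gen_ca_mul,
        smul_smul] <;>
      match_scalars <;> grind
  | hscalar r => simp [Algebra.TensorProduct.algebraMap_apply, antipodeLin_algebraMap]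
  | hmul x y hx hy =>
    rw [Bialgebra.comul_mul, antipode_left_aux hξ _ _ hx, hy, Bialgebra.counit_mul, map_mul,
      Algebra.smul_def]
  | hadd x y hx hy => simp only [map_add, hx, hy]

theorem antipode_right (x : HopfK hξ) :
    LinearMap.mul' k _ ((antipodeLin hξ).lTensor _ (Coalgebra.comul (R := k) x)) =
      algebraMap k _ (Coalgebra.counit (R := k) x) := by
  have h2 := xi_sq hξ
  induction x using HopfK.induction with
  | hgen i =>
    rw [comul_gen, counit_gen]
    cases i <;>
      simp only [comulGen, counitGen, map_add, LinearMap.lTensor_tmul, LinearMap.mul'_apply,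
        antipodeLin_gen, antipodeGen, MulOpposite.unop_op] <;>
      simp [gen_b, gen_d, mul_assoc, gen_aaaa, gen_cc, gen_ca, gen_aaaa_mul, gen_ca_mul,
        smul_smul] <;>
      match_scalars <;> grind
  | hscalar r => simp [Algebra.TensorProduct.algebraMap_apply, antipodeLin_one]
  | hmul x y hx hy =>
    rw [Bialgebra.comul_mul, antipode_right_aux hξ _ _ hy, hx, Bialgebra.counit_mul, map_mul,
      Algebra.smul_def, Algebra.commutes]
  | hadd x y hx hy => simp only [map_add, hx, hy]

instance : HopfAlgebra k (HopfK hξ) where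
  antipode := antipodeLin hξ
  mul_antipode_rTensor_comul := LinearMap.ext (antipode_left hξ)
  mul_antipode_lTensor_comul := LinearMap.ext (antipode_right hξ)

end HopfK

/-! ### The Yetter-Drinfeld module `V₃₁` -/

namespace HopfK

variable {ξ : k} (hξ : IsPrimitiveRoot ξ 4)

/-- Matrices of the action of the generators of `𝒦` on `V₃₁` in the basis `e₁, e₂`. With
`λ₁ = ξ³ = -ξ` and `λ₂ = ξ` one has `a e₁ = λ₁ e₁`, `a e₂ = -ξ λ₁ e₂`, `b e₂ = λ₁² e₁`,
`c e₂ = e₁`, `d e₁ = λ₁⁻¹ e₁`, `d e₂ = ξ λ₁⁻¹ e₂`, that is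
`a e₁ = -ξ e₁`, `a e₂ = -e₂`, `b e₁ = 0`, `b e₂ = -e₁`, `c e₁ = 0`, `c e₂ = e₁`, `d e₁ = ξ e₁`,
`d e₂ = -e₂`. -/
def V31Mat (ξ : k) : KGen → Matrix (Fin 2) (Fin 2) k
  | .a => !![-ξ, 0; 0, -1]
  | .b => !![0, -1; 0, 0]
  | .c => !![0, 1; 0, 0]
  | .d => !![ξ, 0; 0, -1]

/-- The action of `𝒦` on `V₃₁ = k e₁ ⊕ k e₂`. -/
def V31Act : HopfK hξ →ₐ[k] Module.End k (Fin 2 → k) :=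
  lift hξ (fun i => Matrix.toLinAlgEquiv' (V31Mat ξ i)) (by
    have h2 := xi_sq hξ
    have h : ∀ s t, KRel ξ s t →
        FreeAlgebra.lift k (V31Mat ξ) s = FreeAlgebra.lift k (V31Mat ξ) t := by
      intro s t h
      induction h <;> ext i j <;> fin_cases i <;> fin_cases j <;>
        simp [V31Mat, pow_succ, Matrix.mul_apply] <;> grind
    intro s t hst
    have hl : FreeAlgebra.lift k (fun i => Matrix.toLinAlgEquiv' (V31Mat ξ i)) =
        (Matrix.toLinAlgEquiv' : Matrix (Fin 2) (Fin 2) k ≃ₐ[k] _).toAlgHom.comp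
          (FreeAlgebra.lift k (V31Mat ξ)) := by
      ext; simp
    rw [hl]
    exact congrArg Matrix.toLinAlgEquiv' (h s t hst))

theorem V31Act_gen (i : KGen) :
    V31Act hξ (gen hξ i) = Matrix.toLinAlgEquiv' (V31Mat ξ i) := lift_gen _ _ _ _

/-- The basis vectors `e₁ = e 0` and `e₂ = e 1` of `V₃₁`. -/
def e (i : Fin 2) : Fin 2 → k := Pi.single i 1

theorem V31Act_gen_e (i : KGen) (j : Fin 2) :
    V31Act hξ (gen hξ i) (e j) = V31Mat ξ i 0 j • e 0 + V31Mat ξ i 1 j • e 1 := by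
  rw [V31Act_gen]
  ext l
  fin_cases l <;> simp [e]

/-- The coaction of `𝒦` on `V₃₁`: `δ(e₁) = d ⊗ e₁ + (λ₁³ - ξ λ₁) c ⊗ e₂ = d ⊗ e₁ + (ξ - 1) c ⊗ e₂`
and `δ(e₂) = a ⊗ e₂ + (1/2)(λ₁ + ξ λ₁³) b ⊗ e₁ = a ⊗ e₂ - (1/2)(1 + ξ) b ⊗ e₁`, where
`λ₁ = ξ³ = -ξ`. -/
def V31Coact : (Fin 2 → k) →ₗ[k] HopfK hξ ⊗[k] (Fin 2 → k) :=
  (Pi.basisFun k (Fin 2)).constr k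
    ![gen hξ .d ⊗ₜ e 0 + (ξ - 1) • gen hξ .c ⊗ₜ e 1,
      gen hξ .a ⊗ₜ e 1 - (2⁻¹ * (1 + ξ)) • gen hξ .b ⊗ₜ e 0]

theorem V31Coact_zero : V31Coact hξ (e 0) =
    gen hξ .d ⊗ₜ e 0 + (ξ - 1) • gen hξ .c ⊗ₜ e 1 := by
  have h := (Pi.basisFun k (Fin 2)).constr_basis k
    ![gen hξ .d ⊗ₜ[k] (e 0 : Fin 2 → k) + (ξ - 1) • gen hξ .c ⊗ₜ e 1,
      gen hξ .a ⊗ₜ e 1 - (2⁻¹ * (1 + ξ)) • gen hξ .b ⊗ₜ[k] e 0] 0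
  rwa [Pi.basisFun_apply] at h

theorem V31Coact_one : V31Coact hξ (e 1) =
    gen hξ .a ⊗ₜ e 1 - (2⁻¹ * (1 + ξ)) • gen hξ .b ⊗ₜ e 0 := by
  have h := (Pi.basisFun k (Fin 2)).constr_basis k
    ![gen hξ .d ⊗ₜ[k] (e 0 : Fin 2 → k) + (ξ - 1) • gen hξ .c ⊗ₜ e 1,
      gen hξ .a ⊗ₜ e 1 - (2⁻¹ * (1 + ξ)) • gen hξ .b ⊗ₜ[k] e 0] 1
  rwa [Pi.basisFun_apply] at h

theorem e_induction {P : (Fin 2 → k) → Prop} (h0 : P (e 0)) (h1 : P (e 1))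
    (hadd : ∀ x y, P x → P y → P (x + y)) (hsmul : ∀ (r : k) x, P x → P (r • x))
    (x : Fin 2 → k) : P x := by
  have hx : x = x 0 • e 0 + x 1 • e 1 := by
    ext l
    fin_cases l <;> simp [e]
  rw [hx]
  exact hadd _ _ (hsmul _ _ h0) (hsmul _ _ h1)

theorem two_ne_zero {ξ : k} (hξ : IsPrimitiveRoot ξ 4) : (2 : k) ≠ 0 := by
  intro h
  have h2 := xi_sq hξ
  exact hξ.pow_ne_one_of_pos_of_lt (l := 2) (by norm_num) (by norm_num)
    (by linear_combination h2 - h)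

set_option maxHeartbeats 2000000 in
theorem V31_compat_zero (i : KGen) :
    V31Coact hξ (V31Act hξ (gen hξ i) (e 0)) =
      ydTwist k (HopfK hξ) (V31Act hξ) (gen hξ i) (V31Coact hξ (e 0)) := by
  have h2 := xi_sq hξ
  have h3 := two_ne_zero hξ
  have hS : ∀ i, HopfAlgebra.antipode k (gen hξ i) = (antipodeGen hξ i).unop :=
    antipodeLin_gen hξ
  cases i <;>
    simp only [V31Act_gen_e, V31Mat, V31Coact_zero, V31Coact_one, ydTwist,
      LinearMap.comp_apply, comul_gen, comulGen, LinearMap.lTensor_tmul, map_add,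
      map_smul, TensorProduct.tmul_add, LinearMap.add_apply, ydOperator_apply, hS,
      antipodeGen, MulOpposite.unop_op] <;>
    simp [gen_b, gen_d, mul_assoc, gen_aaaa, gen_cc, gen_ca, gen_aaaa_mul, gen_ca_mul,
      smul_smul, ← TensorProduct.smul_tmul', TensorProduct.neg_tmul,
      TensorProduct.tmul_neg, TensorProduct.tmul_smul] <;>
    match_scalars <;> grind

set_option maxHeartbeats 2000000 in
theorem V31_compat_one (i : KGen) :
    V31Coact hξ (V31Act hξ (gen hξ i) (e 1)) =
      ydTwist k (HopfK hξ) (V31Act hξ) (gen hξ i) (V31Coact hξ (e 1)) := by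
  have h2 := xi_sq hξ
  have h3 := two_ne_zero hξ
  have hS : ∀ i, HopfAlgebra.antipode k (gen hξ i) = (antipodeGen hξ i).unop :=
    antipodeLin_gen hξ
  cases i <;>
    simp only [V31Act_gen_e, V31Mat, V31Coact_zero, V31Coact_one, ydTwist,
      LinearMap.comp_apply, comul_gen, comulGen, LinearMap.lTensor_tmul, map_add, map_sub,
      map_smul, TensorProduct.tmul_add, LinearMap.add_apply, ydOperator_apply, hS,
      antipodeGen, MulOpposite.unop_op] <;>
    simp [gen_b, gen_d, mul_assoc, gen_aaaa, gen_cc, gen_ca, gen_aaaa_mul, gen_ca_mul,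
      smul_smul, ← TensorProduct.smul_tmul', TensorProduct.neg_tmul,
      TensorProduct.tmul_neg, TensorProduct.tmul_smul] <;>
    match_scalars <;> grind

theorem V31_coassoc (m : Fin 2 → k) :
    TensorProduct.assoc k (HopfK hξ) (HopfK hξ) (Fin 2 → k)
        ((Coalgebra.comul (R := k) (A := HopfK hξ)).rTensor (Fin 2 → k) (V31Coact hξ m)) =
      (V31Coact hξ).lTensor (HopfK hξ) (V31Coact hξ m) := by
  have h2 := xi_sq hξ
  have h3 := two_ne_zero hξ
  induction m using e_induction with
  | h0 =>
    simp only [V31Coact_zero, V31Coact_one, map_add, map_smul, LinearMap.rTensor_tmul,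
      LinearMap.lTensor_tmul, comul_gen, comulGen, TensorProduct.add_tmul,
      TensorProduct.tmul_add, TensorProduct.assoc_tmul, TensorProduct.tmul_sub,
      TensorProduct.tmul_smul, smul_add, smul_sub, smul_smul]
    match_scalars <;> grind
  | h1 =>
    simp only [V31Coact_zero, V31Coact_one, map_add, map_sub, map_smul, LinearMap.rTensor_tmul,
      LinearMap.lTensor_tmul, comul_gen, comulGen, TensorProduct.add_tmul,
      TensorProduct.tmul_add, TensorProduct.assoc_tmul, TensorProduct.tmul_sub,
      TensorProduct.tmul_smul, smul_add, smul_sub, smul_smul]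
    match_scalars <;> grind
  | hadd x y hx hy => simp only [map_add, hx, hy]
  | hsmul r x hx => simp only [map_smul, hx]

/-- The Yetter-Drinfeld module `V₃₁` over `𝒦`. -/
def V31 : YetterDrinfeldModule k (HopfK hξ) (Fin 2 → k) where
  act := V31Act hξ
  coact := V31Coact hξ
  coassoc := V31_coassoc hξ
  counit_coact m := by
    induction m using e_induction with
    | h0 => simp [V31Coact_zero, counit_gen, counitGen]
    | h1 => simp [V31Coact_one, counit_gen, counitGen]
    | hadd x y hx hy => simp only [map_add, hx, hy]
    | hsmul r x hx => simp only [map_smul, hx]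
  compat h := by
    induction h using HopfK.induction with
    | hscalar r =>
      intro m
      rw [ydTwist_algebraMap, AlgHom.commutes, Module.algebraMap_end_apply, map_smul]
    | hmul x y hx hy =>
      intro m
      rw [map_mul, Module.End.mul_apply, hx, hy, ydTwist_mul]
    | hadd x y hx hy =>
      intro m
      rw [map_add, map_add, LinearMap.add_apply, LinearMap.add_apply, map_add, hx, hy]
    | hgen i =>
      intro m
      induction m using e_induction with
      | h0 => exact V31_compat_zero hξ i
      | h1 => exact V31_compat_one hξ i
      | hadd x y hx hy => simp only [map_add, hx, hy]
      | hsmul r x hx => simp only [map_smul, hx]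

end HopfK

/-- The relations `x² - 2y² = 0`, `xy + yx = 0`, `y⁴ = 0` in the free algebra on `x = X₀` and
`y = X₁`. -/
inductive V31Rel (k : Type u) [Field k] : FreeAlgebra k (Fin 2) → FreeAlgebra k (Fin 2) → Prop
  | xx_yy : V31Rel k (FreeAlgebra.ι k 0 ^ 2 - 2 * FreeAlgebra.ι k 1 ^ 2) 0
  | xy_yx : V31Rel k
      (FreeAlgebra.ι k 0 * FreeAlgebra.ι k 1 + FreeAlgebra.ι k 1 * FreeAlgebra.ι k 0) 0
  | yyyy : V31Rel k (FreeAlgebra.ι k 1 ^ 4) 0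

end HopfK

end

noncomputable section

universe u v w

/-! Let `J` be the ideal of T(V) generated by x² - 2y², xy + yx, y⁴, and A = T(V)/J with projection
π. The point is that `J` equals the Nichols ideal.

`J` is contained in it: `J` is generated in degrees 2 and 4, so only the coideal property is at
stake. The action of 𝒦 descends to A (`toPres_tensorAct`), and on A ⊗ A the operators of left
multiplication by v ⊗ 1 + 1 ⊗ v satisfy the three relations (`V31Alg.braid`). Hence (π ⊗ π)Δ factors
through A (`map_toPres_tensorComul`) and kills `J`. Its value Δ(J) then lies in ker(π ⊗ π) = J ⊗
T(V) + T(V) ⊗ J.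

Nothing more is contained in it: A is spanned by the eight monomials yⁱ, xyⁱ with i < 4. A
nontrivial combination of them becomes a nonzero multiple of xy³ after left multiplication by a
suitable monomial, so an element of the Nichols ideal outside `J` would force xy³ into that ideal.
But the ideal is stable under the skew derivations t ↦ f(t₍₁₎) t₍₂₎ (`skewDer_mem`), four of which
send xy³ to the nonzero constant (1 - ξ)/2 (`der_socle`), whereas the ideal has no constant terms.
The same argument, applied to preimages of 0, shows that the eight monomials are independent, which
gives the dimension. -/

theorem TensorAlgebra.induction_ι_mul {k : Type*} [CommRing k] {V : Type*} [AddCommGroup V]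
    [Module k V] {P : TensorAlgebra k V → Prop} (hone : P 1)
    (hadd : ∀ s t, P s → P t → P (s + t)) (hsmul : ∀ (r : k) t, P t → P (r • t))
    (hmul : ∀ v t, P t → P (TensorAlgebra.ι k v * t)) (t : TensorAlgebra k V) : P t := by
  -- Carrying an arbitrary right factor `s` lets the product case compose its two induction
  -- hypotheses.
  have key : ∀ s, P s → P (t * s) := by
    induction t using TensorAlgebra.induction with
    | algebraMap r => intro s hs; rw [← Algebra.smul_def]; exact hsmul r s hs
    | ι v => exact hmul v
    | mul x y hx hy => intro s hs; rw [mul_assoc]; exact hx _ (hy s hs)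
    | add x y hx hy => intro s hs; rw [add_mul]; exact hadd _ _ (hx s hs) (hy s hs)
  simpa using key 1 hone

/-! ### Action and comultiplication of T(V), letter by letter -/

namespace YetterDrinfeldModule

variable {k : Type u} [Field k] {H : Type v} [Ring H] [HopfAlgebra k H]
  {V : Type w} [AddCommGroup V] [Module k V] (M : YetterDrinfeldModule k H V)

theorem tensorAct_one (h : H) :
    M.tensorAct h 1 = algebraMap k _ (Coalgebra.counit (R := k) h) := by
  simp [tensorAct]

/-- `tensorAct` is an algebra map into a convolution algebra, whose product is multiplication after
Δ(h). -/
theorem tensorAct_ι_mul (h : H) (v : V) (t : TensorAlgebra k V) :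
    M.tensorAct h (TensorAlgebra.ι k v * t) =
      LinearMap.mul' k _ (TensorProduct.map (TensorAlgebra.ι k ∘ₗ M.act.toLinearMap.flip v)
        (M.tensorAct.flip t) (Coalgebra.comul (R := k) h)) := by
  simp only [tensorAct, LinearMap.flip_apply, LinearMap.comp_apply, AlgHom.toLinearMap_apply,
    map_mul, TensorAlgebra.lift_ι_apply]
  rfl

theorem tensorAct_one_left (t : TensorAlgebra k V) : M.tensorAct 1 t = t := by
  induction t using TensorAlgebra.induction_ι_mul with
  | hone => rw [tensorAct_one, Bialgebra.counit_one, map_one]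
  | hadd s t hs ht => rw [map_add, hs, ht]
  | hsmul r t ht => rw [map_smul, ht]
  | hmul v t ht => simp [tensorAct_ι_mul, Algebra.TensorProduct.one_def, ht]

theorem tensorCoact_ι (v : V) :
    M.tensorCoact (TensorAlgebra.ι k v) = (TensorAlgebra.ι k).lTensor H (M.coact v) := by
  simp [tensorCoact]

theorem braidedMul_tmul (x y z w : TensorAlgebra k V) :
    M.braidedMul (x ⊗ₜ y) (z ⊗ₜ w) =
      TensorProduct.map (LinearMap.mulLeft k x ∘ₗ M.tensorAct.flip z) (LinearMap.mulRight k w)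
        (M.tensorCoact y) := by
  simp only [braidedMul, tensorBraiding, TensorProduct.curry_apply, LinearMap.comp_apply,
    LinearEquiv.coe_coe, TensorProduct.assoc_tmul, LinearMap.lTensor_tmul,
    TensorProduct.assoc_symm_tmul, LinearMap.rTensor_tmul, AlgHom.toLinearMap_apply]
  induction M.tensorCoact y using TensorProduct.induction_on with
  | zero => simp
  | tmul h t => simp
  | add s t hs ht =>
    simp only [TensorProduct.add_tmul, TensorProduct.tmul_add, map_add, hs, ht]

theorem braidedMul_tmul_one (x z w : TensorAlgebra k V) :
    M.braidedMul (x ⊗ₜ 1) (z ⊗ₜ w) = (x * z) ⊗ₜ w := by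
  simp [braidedMul_tmul, Algebra.TensorProduct.one_def, tensorAct_one_left]

theorem tensorComul_one : M.tensorComul 1 = 1 ⊗ₜ 1 := by
  simp [tensorComul]

theorem tensorComul_ι_mul (v : V) (t : TensorAlgebra k V) :
    M.tensorComul (TensorAlgebra.ι k v * t) =
      M.braidedMul (TensorAlgebra.ι k v ⊗ₜ 1 + 1 ⊗ₜ TensorAlgebra.ι k v) (M.tensorComul t) := by
  simp [tensorComul]

/-! ### Components of degree 0 and 1 -/

theorem fst_toTrivSqZeroExt [Module kᵐᵒᵖ V] [IsCentralScalar k V] (t : TensorAlgebra k V) :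
    (TensorAlgebra.toTrivSqZeroExt t).fst = TensorAlgebra.algebraMapInv t := by
  induction t using TensorAlgebra.induction with
  | algebraMap r =>
    rw [AlgHom.commutes, TrivSqZeroExt.algebraMap_eq_inl, TrivSqZeroExt.fst_inl,
      AlgHom.commutes, Algebra.algebraMap_self_apply]
  | ι v => simp [TensorAlgebra.algebraMapInv]
  | mul x y hx hy => simp [hx, hy]
  | add x y hx hy => simp [hx, hy]

theorem ιInv_one : TensorAlgebra.ιInv (1 : TensorAlgebra k V) = 0 := by
  rw [TensorAlgebra.ιInv]
  -- The square-zero extension k ⊕ V needs a right action on V; this is the one built into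
  -- `TensorAlgebra.ιInv`.
  let : Module kᵐᵒᵖ V := Module.compHom _ ((RingHom.id k).fromOpposite mul_comm)
  have : IsCentralScalar k V := ⟨fun r m => rfl⟩
  change (TensorAlgebra.toTrivSqZeroExt (1 : TensorAlgebra k V)).snd = 0
  rw [map_one, TrivSqZeroExt.snd_one]

theorem ιInv_ι_mul (v : V) (t : TensorAlgebra k V) :
    TensorAlgebra.ιInv (TensorAlgebra.ι k v * t) = TensorAlgebra.algebraMapInv t • v := by
  let : Module kᵐᵒᵖ V := Module.compHom _ ((RingHom.id k).fromOpposite mul_comm)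
  have : IsCentralScalar k V := ⟨fun r m => rfl⟩
  simp [TensorAlgebra.ιInv, TensorAlgebra.toTrivSqZeroExt_ι, fst_toTrivSqZeroExt]

theorem algebraMapInv_ι (v : V) : TensorAlgebra.algebraMapInv (TensorAlgebra.ι k v) = 0 := by
  simp [TensorAlgebra.algebraMapInv]

theorem algebraMapInv_tensorAct (h : H) (t : TensorAlgebra k V) :
    TensorAlgebra.algebraMapInv (M.tensorAct h t) =
      Coalgebra.counit (R := k) h * TensorAlgebra.algebraMapInv t := by
  induction t using TensorAlgebra.induction_ι_mul with
  | hone => simp [tensorAct_one]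
  | hadd s t hs ht => simp only [map_add, hs, ht, mul_add]
  | hsmul r t ht => simp only [map_smul, ht, smul_eq_mul]; ring
  | hmul v t _ =>
    rw [tensorAct_ι_mul, map_mul, algebraMapInv_ι, zero_mul, mul_zero]
    induction Coalgebra.comul (R := k) h using TensorProduct.induction_on with
    | zero => simp
    | tmul p q => simp [algebraMapInv_ι]
    | add s t hs ht => simp only [map_add, hs, ht, add_zero]

/-- On a product vt only the constant term of t reaches degree one. The second leg of Δ(h) acts on
it by the counit, and the counit axiom leaves h acting on v. -/
theorem ιInv_tensorAct (h : H) (t : TensorAlgebra k V) :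
    TensorAlgebra.ιInv (M.tensorAct h t) = M.act h (TensorAlgebra.ιInv t) := by
  induction t using TensorAlgebra.induction_ι_mul with
  | hone => simp [tensorAct_one, Algebra.algebraMap_eq_smul_one, ιInv_one]
  | hadd s t hs ht => simp only [map_add, hs, ht]
  | hsmul r t ht => simp only [map_smul, ht]
  | hmul v t _ =>
    rw [tensorAct_ι_mul, ιInv_ι_mul, map_smul]
    have key : ∀ z : H ⊗[k] H, TensorAlgebra.ιInv (LinearMap.mul' k _
        (TensorProduct.map (TensorAlgebra.ι k ∘ₗ M.act.toLinearMap.flip v)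
          (M.tensorAct.flip t) z)) = TensorAlgebra.algebraMapInv t •
          M.act (TensorProduct.rid k H ((Coalgebra.counit (R := k)).lTensor H z)) v := by
      intro z
      induction z using TensorProduct.induction_on with
      | zero => simp
      | tmul p q => simp [ιInv_ι_mul, algebraMapInv_tensorAct, smul_smul, mul_comm]
      | add s t hs ht => simp only [map_add, hs, ht, LinearMap.add_apply, smul_add]
    rw [key, Coalgebra.lTensor_counit_comul]
    simp

/-- An element of an ideal generated in degrees at least `2` has no components of degree
`0` and `1`. -/
theorem algebraMapInv_and_ιInv_eq_zero_of_mem {I : TwoSidedIdeal (TensorAlgebra k V)}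
    (hI : I ∈ M.nicholsIdeals) {t : TensorAlgebra k V} (ht : t ∈ I) :
    TensorAlgebra.algebraMapInv t = 0 ∧ TensorAlgebra.ιInv t = 0 := by
  let : Module kᵐᵒᵖ V := Module.compHom _ ((RingHom.id k).fromOpposite mul_comm)
  have : IsCentralScalar k V := ⟨fun r m => rfl⟩
  obtain ⟨⟨S, hS, rfl⟩, -⟩ := hI
  -- The algebra map T(V) → k ⊕ V with V² = 0 kills products of two vectors, hence all generators of
  -- degree at least 2. Its two components are the projections in question.
  have h : TwoSidedIdeal.span S ≤
      TwoSidedIdeal.ker (TensorAlgebra.toTrivSqZeroExt (R := k) (M := V)) := by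
    rw [TwoSidedIdeal.span_le]
    intro s hs
    obtain ⟨n, hn, hs⟩ := hS s hs
    obtain ⟨m, rfl⟩ := Nat.exists_eq_add_of_le hn
    rw [pow_add, pow_two] at hs
    rw [SetLike.mem_coe, TwoSidedIdeal.mem_ker]
    rename s ∈ S => hsS
    clear hsS
    induction hs using Submodule.mul_induction_on' with
    | mem_mul_mem x hx y hy =>
      rw [map_mul]
      suffices TensorAlgebra.toTrivSqZeroExt x = 0 by rw [this, zero_mul]
      induction hx using Submodule.mul_induction_on' with
      | mem_mul_mem x hx y hy =>
        obtain ⟨x, rfl⟩ := hx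
        obtain ⟨y, rfl⟩ := hy
        rw [map_mul, TensorAlgebra.toTrivSqZeroExt_ι, TensorAlgebra.toTrivSqZeroExt_ι,
          TrivSqZeroExt.inr_mul_inr]
      | add x _ y _ hx hy => rw [map_add, hx, hy, add_zero]
    | add x _ y _ hx hy => rw [map_add, hx, hy, add_zero]
  have h0 := (TwoSidedIdeal.mem_ker _).1 (h ht)
  refine ⟨by rw [← fst_toTrivSqZeroExt, h0, TrivSqZeroExt.fst_zero], ?_⟩
  simp [TensorAlgebra.ιInv, h0]

/-! ### Skew derivations -/

/-- The skew derivation `t ↦ f(t₍₁₎) t₍₂₎` of `T(V)` given by a linear form on `V`. -/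
def skewDer (f : V →ₗ[k] k) : TensorAlgebra k V →ₗ[k] TensorAlgebra k V :=
  (TensorProduct.lid k _).toLinearMap ∘ₗ
    (f ∘ₗ TensorAlgebra.ιInv).rTensor (TensorAlgebra k V) ∘ₗ M.tensorComul

theorem skewDer_one (f : V →ₗ[k] k) : M.skewDer f 1 = 0 := by
  simp [skewDer, tensorComul_one, ιInv_one]

theorem counit_tensorComul (t : TensorAlgebra k V) :
    TensorProduct.lid k _
      ((TensorAlgebra.algebraMapInv (R := k) (M := V)).toLinearMap.rTensor _ (M.tensorComul t)) =
        t := by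
  induction t using TensorAlgebra.induction_ι_mul with
  | hone => simp [tensorComul_one]
  | hadd s t hs ht => simp only [map_add, hs, ht]
  | hsmul r t ht => simp only [map_smul, ht]
  | hmul v t ht =>
    rw [tensorComul_ι_mul]
    -- Writing t as (ε ⊗ id)Δ(t) makes both sides linear in Δ(t), which can then be replaced by a
    -- pure tensor.
    conv_rhs => rw [← ht]
    clear ht
    induction M.tensorComul t using TensorProduct.induction_on with
    | zero => simp
    | add s t hs ht => rw [map_add, map_add, map_add, hs, ht, map_add, map_add, mul_add]
    | tmul z w =>
      rw [map_add, LinearMap.add_apply, braidedMul_tmul_one, braidedMul_tmul, tensorCoact_ι]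
      have hc := M.counit_coact v
      have key : ∀ c : H ⊗[k] V, TensorProduct.lid k _
          ((TensorAlgebra.algebraMapInv (R := k) (M := V)).toLinearMap.rTensor _
            (TensorProduct.map (LinearMap.mulLeft k 1 ∘ₗ M.tensorAct.flip z)
              (LinearMap.mulRight k w) ((TensorAlgebra.ι k).lTensor H c))) =
          TensorAlgebra.algebraMapInv z • (TensorAlgebra.ι k (TensorProduct.lid k V
            ((Coalgebra.counit (R := k) (A := H)).rTensor V c)) * w) := by
        intro c
        induction c using TensorProduct.induction_on with
        | zero => simp
        | add s t hs ht => simp only [map_add, hs, ht, add_mul, smul_add]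
        | tmul p q => simp [algebraMapInv_tensorAct, smul_smul, mul_comm]
      rw [map_add, map_add, key, hc]
      simp [algebraMapInv_ι]

/-- Twisted Leibniz rule. The summand v ⊗ 1 of Δ(v) contributes f(v)(ε ⊗ id)Δ(t) = f(v)t. The
summand 1 ⊗ v passes v₍₋₁₎ to the left leg of Δ(t), where it is absorbed into f because the
degree-one projection is H-linear. -/
theorem skewDer_ι_mul (f : V →ₗ[k] k) {v : V} {ι : Type*} {s : Finset ι} {h : ι → H} {m : ι → V}
    (hv : M.coact v = ∑ i ∈ s, h i ⊗ₜ m i) (t : TensorAlgebra k V) :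
    M.skewDer f (TensorAlgebra.ι k v * t) =
      f v • t + ∑ i ∈ s, TensorAlgebra.ι k (m i) * M.skewDer (f ∘ₗ M.act (h i)) t := by
  simp only [skewDer, LinearMap.comp_apply, tensorComul_ι_mul]
  conv_rhs => enter [1]; rw [← M.counit_tensorComul t]
  induction M.tensorComul t using TensorProduct.induction_on with
  | zero => simp
  | add x y hx hy =>
    generalize M.braidedMul _ = B at hx hy ⊢
    simp only [map_add, hx, hy, smul_add, mul_add, Finset.sum_add_distrib]
    abel
  | tmul z w =>
    rw [map_add, LinearMap.add_apply, braidedMul_tmul_one, braidedMul_tmul, tensorCoact_ι, hv]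
    simp [ιInv_tensorAct, ιInv_ι_mul, smul_smul, mul_comm]

theorem skewDer_mem {I : TwoSidedIdeal (TensorAlgebra k V)} (hI : I ∈ M.nicholsIdeals)
    (f : V →ₗ[k] k) {t : TensorAlgebra k V} (ht : t ∈ I) : M.skewDer f t ∈ I := by
  have hs : ∀ (r : k) (x : TensorAlgebra k V), x ∈ I → r • x ∈ I := fun r x hx => by
    rw [Algebra.smul_def]; exact I.mul_mem_left _ _ hx
  have h := hI.2 t ht
  rw [skewDer, LinearMap.comp_apply, LinearMap.comp_apply]
  generalize M.tensorComul t = c at h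
  -- The form f ∘ `ιInv` vanishes on I, so the part in I ⊗ T(V) dies, and the part in T(V) ⊗ I lands
  -- in I.
  induction h using Submodule.span_induction with
  | mem z hz =>
    obtain ⟨x, hx, y, rfl | rfl⟩ := hz
    · simp [(M.algebraMapInv_and_ιInv_eq_zero_of_mem hI hx).2, I.zero_mem]
    · simpa using hs _ _ hx
  | zero => simp [I.zero_mem]
  | add x y _ _ hx hy => simpa only [map_add] using I.add_mem hx hy
  | smul r x _ hx => simpa only [map_smul] using hs r _ hx

end YetterDrinfeldModule

/-! ### The presented algebra -/

/-- The algebra presented by `x² = 2y²`, `xy = -yx`, `y⁴ = 0`. -/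
def V31Alg (k : Type u) [Field k] : Type u := RingQuot (V31Rel k)

namespace V31Alg

variable (k : Type u) [Field k]

instance : Ring (V31Alg k) := inferInstanceAs (Ring (RingQuot (V31Rel k)))
instance : Algebra k (V31Alg k) := inferInstanceAs (Algebra k (RingQuot (V31Rel k)))

/-- The quotient map from the free algebra. -/
def mk : FreeAlgebra k (Fin 2) →ₐ[k] V31Alg k := RingQuot.mkAlgHom k (V31Rel k)

theorem mk_rel {s t : FreeAlgebra k (Fin 2)} (h : V31Rel k s t) : mk k s = mk k t :=
  RingQuot.mkAlgHom_rel k h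

theorem mk_surjective : Function.Surjective (mk k) := RingQuot.mkAlgHom_surjective k (V31Rel k)

/-- The generators `x = gen 0` and `y = gen 1`. -/
def gen (i : Fin 2) : V31Alg k := mk k (FreeAlgebra.ι k i)

theorem mk_ι (i : Fin 2) : mk k (FreeAlgebra.ι k i) = gen k i := rfl

theorem xx : gen k 0 * gen k 0 = (2 : k) • (gen k 1 * gen k 1) := by
  have h := mk_rel k (V31Rel.xx_yy (k := k))
  have h2 : (2 : FreeAlgebra k (Fin 2)) = (2 : k) • 1 := by
    rw [← Algebra.algebraMap_eq_smul_one, map_ofNat]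
  rw [h2] at h
  simp only [map_sub, map_mul, map_zero, map_smul, pow_two, smul_mul_assoc,
    one_mul, mk_ι] at h
  exact sub_eq_zero.1 h

theorem yx : gen k 1 * gen k 0 = -(gen k 0 * gen k 1) := by
  have h := mk_rel k (V31Rel.xy_yx (k := k))
  simp only [map_add, map_mul, map_zero, mk_ι] at h
  exact eq_neg_of_add_eq_zero_right h

theorem yyyy : gen k 1 * (gen k 1 * (gen k 1 * gen k 1)) = 0 := by
  have h := mk_rel k (V31Rel.yyyy (k := k))
  simpa only [map_mul, map_zero, pow_succ, pow_zero, one_mul, mul_assoc, mk_ι] using h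

theorem xx_mul (z : V31Alg k) :
    gen k 0 * (gen k 0 * z) = (2 : k) • (gen k 1 * (gen k 1 * z)) := by
  rw [← mul_assoc, xx, smul_mul_assoc, mul_assoc]

theorem yx_mul (z : V31Alg k) : gen k 1 * (gen k 0 * z) = -(gen k 0 * (gen k 1 * z)) := by
  rw [← mul_assoc, yx, neg_mul, mul_assoc]

theorem yyyy_mul (z : V31Alg k) : gen k 1 * (gen k 1 * (gen k 1 * (gen k 1 * z))) = 0 := by
  have h := congrArg (· * z) (yyyy k)
  simpa only [mul_assoc, zero_mul] using h

variable {k}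

theorem hom_rel {B : Type*} [Ring B] [Algebra k B] {f : Fin 2 → B}
    (hxx : f 0 * f 0 = (2 : k) • (f 1 * f 1)) (hyx : f 1 * f 0 = -(f 0 * f 1))
    (hyyyy : f 1 * f 1 * (f 1 * f 1) = 0) ⦃s t : FreeAlgebra k (Fin 2)⦄ (h : V31Rel k s t) :
    FreeAlgebra.lift k f s = FreeAlgebra.lift k f t := by
  have h2 : (2 : FreeAlgebra k (Fin 2)) = (2 : k) • 1 := by
    rw [← Algebra.algebraMap_eq_smul_one, map_ofNat]
  induction h with
  | xx_yy =>
    rw [h2]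
    simp [pow_two, hxx]
  | xy_yx => simp [hyx]
  | yyyy => simp [pow_succ, ← hyyyy, mul_assoc]

/-- The algebra map with given values on the generators. -/
def lift {B : Type*} [Ring B] [Algebra k B] (f : Fin 2 → B)
    (hxx : f 0 * f 0 = (2 : k) • (f 1 * f 1)) (hyx : f 1 * f 0 = -(f 0 * f 1))
    (hyyyy : f 1 * f 1 * (f 1 * f 1) = 0) : V31Alg k →ₐ[k] B :=
  RingQuot.liftAlgHom k ⟨FreeAlgebra.lift k f, hom_rel hxx hyx hyyyy⟩

theorem lift_gen {B : Type*} [Ring B] [Algebra k B] (f : Fin 2 → B)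
    (hxx : f 0 * f 0 = (2 : k) • (f 1 * f 1)) (hyx : f 1 * f 0 = -(f 0 * f 1))
    (hyyyy : f 1 * f 1 * (f 1 * f 1) = 0) (i : Fin 2) :
    lift f hxx hyx hyyyy (gen k i) = f i := by
  have h : lift f hxx hyx hyyyy (gen k i) = FreeAlgebra.lift k f (FreeAlgebra.ι k i) :=
    RingQuot.liftAlgHom_mkAlgHom_apply k (FreeAlgebra.lift k f) (hom_rel hxx hyx hyyyy) _
  rw [h, FreeAlgebra.lift_ι_apply]

theorem induction_mul {P : V31Alg k → Prop} (hone : P 1)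
    (hadd : ∀ s t, P s → P t → P (s + t)) (hsmul : ∀ (r : k) t, P t → P (r • t))
    (hmul : ∀ i t, P t → P (gen k i * t)) (t : V31Alg k) : P t := by
  have key : ∀ s, P s → P (t * s) := by
    obtain ⟨t, rfl⟩ := mk_surjective k t
    induction t using FreeAlgebra.induction with
    | grade0 r =>
      intro s hs
      rw [AlgHom.commutes, ← Algebra.smul_def]
      exact hsmul r s hs
    | grade1 i => exact hmul i
    | mul x y hx hy => intro s hs; rw [map_mul, mul_assoc]; exact hx _ (hy s hs)
    | add x y hx hy => intro s hs; rw [map_add, add_mul]; exact hadd _ _ (hx s hs) (hy s hs)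
  simpa using key 1 hone

variable {ξ : k} (hξ : IsPrimitiveRoot ξ 4)

/-! ### The action of 𝒦 on the presented algebra -/

/-- The matrices of the values at the generators of the matrix coefficients of the action of `𝒦`.-/
def matGen (ξ : k) : Fin 2 → Matrix (Fin 2) (Fin 2) (V31Alg k)
  | 0 => !![-ξ • gen k 0, 0; 0, ξ • gen k 0]
  | 1 => !![-gen k 1, -gen k 0; gen k 0, -gen k 1]

/-- The algebra map `z ↦ (a·z, b·z; c·z, d·z)` which describes the action of the generators of `𝒦`
on the presented algebra. -/
def matAct : V31Alg k →ₐ[k] Matrix (Fin 2) (Fin 2) (V31Alg k) :=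
  -- Since Δ is the matrix comultiplication on (a, b; c, d), acting compatibly with products means
  -- exactly that z ↦ (a·z, b·z; c·z, d·z) is multiplicative.
  lift (matGen ξ)
    (by
      have h2 := HopfK.xi_sq hξ
      ext i j
      fin_cases i <;> fin_cases j <;> simp [matGen, Matrix.mul_apply, xx, yx, smul_smul] <;>
        match_scalars <;> grind)
    (by
      have h2 := HopfK.xi_sq hξ
      ext i j
      fin_cases i <;> fin_cases j <;> simp [matGen, Matrix.mul_apply, xx, yx, smul_smul])
    (by
      ext i j
      fin_cases i <;> fin_cases j <;>
        simp [matGen, Matrix.mul_apply, add_mul, mul_add, mul_assoc, xx, yx, yyyy])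

/-- The action of the generators of `𝒦` on the presented algebra. -/
def op : KGen → V31Alg k →ₗ[k] V31Alg k
  | .a => Matrix.entryLinearMap k (V31Alg k) 0 0 ∘ₗ (matAct hξ).toLinearMap
  | .b => Matrix.entryLinearMap k (V31Alg k) 0 1 ∘ₗ (matAct hξ).toLinearMap
  | .c => Matrix.entryLinearMap k (V31Alg k) 1 0 ∘ₗ (matAct hξ).toLinearMap
  | .d => Matrix.entryLinearMap k (V31Alg k) 1 1 ∘ₗ (matAct hξ).toLinearMap

theorem op_one (i : KGen) : op hξ i 1 = algebraMap k _ (HopfK.counitGen i) := by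
  cases i <;> simp [op, HopfK.counitGen]

theorem matAct_gen (i : Fin 2) : matAct hξ (gen k i) = matGen ξ i := lift_gen _ _ _ _ i

theorem a_x (z : V31Alg k) : op hξ .a (gen k 0 * z) = -ξ • (gen k 0 * op hξ .a z) := by
  simp only [op, LinearMap.comp_apply, AlgHom.toLinearMap_apply, map_mul, matAct_gen,
    Matrix.entryLinearMap_apply, Matrix.mul_apply, Fin.sum_univ_two]
  simp [matGen]

theorem b_x (z : V31Alg k) : op hξ .b (gen k 0 * z) = -ξ • (gen k 0 * op hξ .b z) := by
  simp only [op, LinearMap.comp_apply, AlgHom.toLinearMap_apply, map_mul, matAct_gen,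
    Matrix.entryLinearMap_apply, Matrix.mul_apply, Fin.sum_univ_two]
  simp [matGen]

theorem c_x (z : V31Alg k) : op hξ .c (gen k 0 * z) = ξ • (gen k 0 * op hξ .c z) := by
  simp only [op, LinearMap.comp_apply, AlgHom.toLinearMap_apply, map_mul, matAct_gen,
    Matrix.entryLinearMap_apply, Matrix.mul_apply, Fin.sum_univ_two]
  simp [matGen]

theorem d_x (z : V31Alg k) : op hξ .d (gen k 0 * z) = ξ • (gen k 0 * op hξ .d z) := by
  simp only [op, LinearMap.comp_apply, AlgHom.toLinearMap_apply, map_mul, matAct_gen,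
    Matrix.entryLinearMap_apply, Matrix.mul_apply, Fin.sum_univ_two]
  simp [matGen]

theorem a_y (z : V31Alg k) :
    op hξ .a (gen k 1 * z) = -(gen k 1 * op hξ .a z) - gen k 0 * op hξ .c z := by
  simp only [op, LinearMap.comp_apply, AlgHom.toLinearMap_apply, map_mul, matAct_gen,
    Matrix.entryLinearMap_apply, Matrix.mul_apply, Fin.sum_univ_two]
  simp [matGen, sub_eq_add_neg]

theorem b_y (z : V31Alg k) :
    op hξ .b (gen k 1 * z) = -(gen k 1 * op hξ .b z) - gen k 0 * op hξ .d z := by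
  simp only [op, LinearMap.comp_apply, AlgHom.toLinearMap_apply, map_mul, matAct_gen,
    Matrix.entryLinearMap_apply, Matrix.mul_apply, Fin.sum_univ_two]
  simp [matGen, sub_eq_add_neg]

theorem c_y (z : V31Alg k) :
    op hξ .c (gen k 1 * z) = gen k 0 * op hξ .a z - gen k 1 * op hξ .c z := by
  simp only [op, LinearMap.comp_apply, AlgHom.toLinearMap_apply, map_mul, matAct_gen,
    Matrix.entryLinearMap_apply, Matrix.mul_apply, Fin.sum_univ_two]
  simp [matGen, sub_eq_add_neg]

theorem d_y (z : V31Alg k) :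
    op hξ .d (gen k 1 * z) = gen k 0 * op hξ .b z - gen k 1 * op hξ .d z := by
  simp only [op, LinearMap.comp_apply, AlgHom.toLinearMap_apply, map_mul, matAct_gen,
    Matrix.entryLinearMap_apply, Matrix.mul_apply, Fin.sum_univ_two]
  simp [matGen, sub_eq_add_neg]

set_option maxHeartbeats 2000000 in
/-- The quadratic relations of `𝒦` hold for the action on the presented algebra. -/
theorem op_op (z : V31Alg k) :
    op hξ .d (op hξ .d z) = op hξ .a (op hξ .a z) ∧ op hξ .a (op hξ .d z) = z ∧
    op hξ .d (op hξ .a z) = z ∧ op hξ .a (op hξ .b z) = op hξ .d (op hξ .c z) ∧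
    op hξ .b (op hξ .a z) = -ξ • op hξ .d (op hξ .c z) ∧
    op hξ .c (op hξ .d z) = ξ • op hξ .d (op hξ .c z) ∧
    op hξ .c (op hξ .a z) = -ξ • op hξ .a (op hξ .c z) ∧
    op hξ .d (op hξ .b z) = op hξ .a (op hξ .c z) ∧
    op hξ .b (op hξ .d z) = ξ • op hξ .a (op hξ .c z) ∧
    op hξ .b (op hξ .b z) = 0 ∧ op hξ .b (op hξ .c z) = 0 ∧
    op hξ .c (op hξ .b z) = 0 ∧ op hξ .c (op hξ .c z) = 0 := by
  -- The relations are proved jointly because moving an operator past x or y mixes them. The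
  -- relations a²c = b and a⁴ = 1 are replaced by quadratic ones, from which they are recovered in
  -- `b_eq` and `aaaa`.
  induction z using induction_mul with
  | hone => simp [op_one, HopfK.counitGen]
  | hadd s t hs ht =>
    obtain ⟨h1, h2, h3, h4, h5, h6, h7, h8, h9, h10, h11, h12, h13⟩ := hs
    obtain ⟨g1, g2, g3, g4, g5, g6, g7, g8, g9, g10, g11, g12, g13⟩ := ht
    simp only [map_add, smul_add, add_zero, h1, h2, h3, h4, h5, h6, h7, h8, h9, h10, h11, h12, h13,
      g1, g2, g3, g4, g5, g6, g7, g8, g9, g10, g11, g12, g13, and_self]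
  | hsmul r t ht =>
    obtain ⟨h1, h2, h3, h4, h5, h6, h7, h8, h9, h10, h11, h12, h13⟩ := ht
    simp only [map_smul, smul_zero, smul_comm r, h1, h2, h3, h4, h5, h6, h7, h8, h9, h10, h11, h12,
      h13, and_self]
  | hmul i t ht =>
    obtain ⟨h1, h2, h3, h4, h5, h6, h7, h8, h9, h10, h11, h12, h13⟩ := ht
    have hx := HopfK.xi_sq hξ
    fin_cases i
    · simp only [Fin.zero_eta, a_x, b_x, c_x, d_x, map_smul, h1, h2, h3, h4, h5, h6, h7, h8, h9,
        h10, h11, h12, h13, mul_zero, smul_zero, mul_smul_comm, smul_smul]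
      refine ⟨?_, ?_, ?_, ?_, ?_, ?_, ?_, ?_, ?_, ?_, ?_, ?_, ?_⟩ <;>
        first | trivial | (match_scalars <;> grind)
    · simp only [Fin.mk_one, a_x, b_x, c_x, d_x, a_y, b_y, c_y, d_y, map_sub, map_neg, h1,
        h2, h3, h4, h5, h6, h7, h8, h9, h10, h11, h12, h13, mul_zero, smul_zero, mul_smul_comm,
        smul_smul]
      refine ⟨?_, ?_, ?_, ?_, ?_, ?_, ?_, ?_, ?_, ?_, ?_, ?_, ?_⟩ <;>
        first | trivial | (match_scalars <;> grind)

/-- This and the next four lemmas bring every composite of the operators to the form aⁱcʲ, so that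
tensor identities can be compared coefficientwise. -/
theorem b_eq (z : V31Alg k) : op hξ .b z = op hξ .a (op hξ .a (op hξ .c z)) := by
  have h1 := (op_op hξ (op hξ .b z)).2.1
  rw [← h1, (op_op hξ z).2.2.2.2.2.2.2.1]

theorem d_eq (z : V31Alg k) : op hξ .d z = op hξ .a (op hξ .a (op hξ .a z)) := by
  rw [← (op_op hξ (op hξ .a z)).1, (op_op hξ z).2.2.1]

theorem ca (z : V31Alg k) : op hξ .c (op hξ .a z) = -ξ • op hξ .a (op hξ .c z) :=
  (op_op hξ z).2.2.2.2.2.2.1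

theorem cc (z : V31Alg k) : op hξ .c (op hξ .c z) = 0 :=
  (op_op hξ z).2.2.2.2.2.2.2.2.2.2.2.2

theorem aaaa (z : V31Alg k) : op hξ .a (op hξ .a (op hξ .a (op hξ .a z))) = z := by
  rw [← d_eq, (op_op hξ z).2.2.1]

/-! ### The comultiplication of the presented algebra -/

/-- The left multiplications by `v ⊗ 1 + 1 ⊗ v`, for the generators `v`, of the braided tensor
square of the presented algebra. -/
def braidGen : Fin 2 → Module.End k (V31Alg k ⊗[k] V31Alg k)
  | 0 => TensorProduct.map (LinearMap.mulLeft k (gen k 0)) LinearMap.id +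
      TensorProduct.map (op hξ .d) (LinearMap.mulLeft k (gen k 0)) +
      (ξ - 1) • TensorProduct.map (op hξ .c) (LinearMap.mulLeft k (gen k 1))
  | 1 => TensorProduct.map (LinearMap.mulLeft k (gen k 1)) LinearMap.id +
      TensorProduct.map (op hξ .a) (LinearMap.mulLeft k (gen k 1)) -
      (2⁻¹ * (1 + ξ)) • TensorProduct.map (op hξ .b) (LinearMap.mulLeft k (gen k 0))

theorem braidGen_zero (z w : V31Alg k) :
    braidGen hξ 0 (z ⊗ₜ w) = (gen k 0 * z) ⊗ₜ w + op hξ .d z ⊗ₜ (gen k 0 * w) +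
      (ξ - 1) • op hξ .c z ⊗ₜ (gen k 1 * w) := rfl

theorem braidGen_one (z w : V31Alg k) :
    braidGen hξ 1 (z ⊗ₜ w) = (gen k 1 * z) ⊗ₜ w + op hξ .a z ⊗ₜ (gen k 1 * w) -
      (2⁻¹ * (1 + ξ)) • op hξ .b z ⊗ₜ (gen k 0 * w) := rfl

-- A closed form for the operator of y², shared by the verifications of x² = 2y² and y⁴ = 0.
set_option maxHeartbeats 2000000 in
theorem braidGen_yy (z w : V31Alg k) :
    braidGen hξ 1 (braidGen hξ 1 (z ⊗ₜ w)) = (gen k 1 * (gen k 1 * z)) ⊗ₜ w -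
      (gen k 0 * op hξ .c z) ⊗ₜ (gen k 1 * w) +
      (2⁻¹ * (1 + ξ)) • (gen k 0 * op hξ .d z) ⊗ₜ (gen k 0 * w) +
      op hξ .a (op hξ .a z) ⊗ₜ (gen k 1 * (gen k 1 * w)) +
      ξ • op hξ .d (op hξ .c z) ⊗ₜ (gen k 0 * (gen k 1 * w)) := by
  have h2 := HopfK.xi_sq hξ
  have h3 := HopfK.two_ne_zero hξ
  simp only [braidGen_one, map_add, map_sub, map_smul, d_eq, b_eq, a_x, a_y, c_y, ca, cc, mul_zero,
    yx_mul, xx_mul, TensorProduct.sub_tmul,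
    TensorProduct.neg_tmul, TensorProduct.tmul_neg, TensorProduct.tmul_smul, smul_zero, map_neg,
    ← TensorProduct.smul_tmul', smul_smul, map_zero, TensorProduct.zero_tmul]
  match_scalars <;> grind

set_option maxHeartbeats 2000000 in
theorem braidGen_xx (z w : V31Alg k) :
    braidGen hξ 0 (braidGen hξ 0 (z ⊗ₜ w)) =
      (2 : k) • braidGen hξ 1 (braidGen hξ 1 (z ⊗ₜ w)) := by
  have h2 := HopfK.xi_sq hξ
  have h3 := HopfK.two_ne_zero hξ
  rw [braidGen_yy]
  simp only [braidGen_zero, map_add, map_smul, d_eq, a_x, c_x, ca, cc, aaaa,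
    yx_mul, xx_mul,
    TensorProduct.tmul_neg, TensorProduct.tmul_smul, smul_zero,
    ← TensorProduct.smul_tmul', smul_smul, TensorProduct.zero_tmul]
  match_scalars <;> grind

set_option maxHeartbeats 2000000 in
theorem braidGen_yx (z w : V31Alg k) :
    braidGen hξ 1 (braidGen hξ 0 (z ⊗ₜ w)) = -braidGen hξ 0 (braidGen hξ 1 (z ⊗ₜ w)) := by
  have h2 := HopfK.xi_sq hξ
  have h3 := HopfK.two_ne_zero hξ
  simp only [braidGen_zero, braidGen_one, map_add, map_sub, map_smul, d_eq, b_eq, a_x, a_y, c_x,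
    c_y, ca, cc, aaaa,
    yx_mul, xx_mul, mul_smul_comm, TensorProduct.sub_tmul,
    TensorProduct.neg_tmul, TensorProduct.tmul_neg, TensorProduct.tmul_smul, smul_zero, map_neg,
    ← TensorProduct.smul_tmul', smul_smul, map_zero, TensorProduct.zero_tmul]
  match_scalars <;> grind

set_option maxHeartbeats 2000000 in
theorem braidGen_yyyy (z w : V31Alg k) :
    braidGen hξ 1 (braidGen hξ 1 (braidGen hξ 1 (braidGen hξ 1 (z ⊗ₜ w)))) = 0 := by
  have h2 := HopfK.xi_sq hξ
  have h3 := HopfK.two_ne_zero hξ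
  rw [braidGen_yy]
  simp only [braidGen_yy, map_add, map_sub, map_smul, d_eq, a_x, a_y, c_x,
    c_y, ca, cc, aaaa, mul_sub, mul_add, mul_neg,
    yx_mul, xx_mul, yyyy_mul, mul_smul_comm, TensorProduct.sub_tmul,
    TensorProduct.neg_tmul, TensorProduct.tmul_neg, TensorProduct.tmul_smul, smul_zero, map_neg,
    ← TensorProduct.smul_tmul', smul_smul, map_zero, TensorProduct.zero_tmul, mul_zero,
    TensorProduct.tmul_zero]
  match_scalars <;> grind

/-- The action of the presented algebra on its braided tensor square through its
comultiplication. -/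
def braid : V31Alg k →ₐ[k] Module.End k (V31Alg k ⊗[k] V31Alg k) :=
  -- The relations are checked between endomorphisms, so no associativity of the braided product on
  -- the tensor square is required.
  lift (braidGen hξ)
    (TensorProduct.ext' fun z w => by simpa using braidGen_xx hξ z w)
    (TensorProduct.ext' fun z w => by simpa using braidGen_yx hξ z w)
    (TensorProduct.ext' fun z w => by simpa using braidGen_yyyy hξ z w)

theorem braid_gen (i : Fin 2) : braid hξ (gen k i) = braidGen hξ i := lift_gen _ _ _ _ i

end V31Alg

/-! ### The relation ideal is a coideal -/

namespace HopfK

variable {k : Type u} [Field k]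

theorem tensor_induction {P : TensorAlgebra k (Fin 2 → k) → Prop} (hone : P 1)
    (hadd : ∀ s t, P s → P t → P (s + t)) (hsmul : ∀ (r : k) t, P t → P (r • t))
    (hmul : ∀ i t, P t → P (TensorAlgebra.ι k (e i) * t)) (t : TensorAlgebra k (Fin 2 → k)) :
    P t := by
  induction t using TensorAlgebra.induction_ι_mul with
  | hone => exact hone
  | hadd s t hs ht => exact hadd s t hs ht
  | hsmul r t ht => exact hsmul r t ht
  | hmul v t ht =>
    induction v using e_induction with
    | h0 => exact hmul 0 t ht
    | h1 => exact hmul 1 t ht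
    | hadd x y hx hy => rw [map_add, add_mul]; exact hadd _ _ hx hy
    | hsmul r x hx => rw [map_smul, smul_mul_assoc]; exact hsmul r _ hx

variable (k) in
/-- The algebra map from the tensor algebra to the presented algebra. -/
def toPres : TensorAlgebra k (Fin 2 → k) →ₐ[k] V31Alg k :=
  TensorAlgebra.lift k ((Pi.basisFun k (Fin 2)).constr k (V31Alg.gen k))

theorem toPres_ι (i : Fin 2) : toPres k (TensorAlgebra.ι k (e i)) = V31Alg.gen k i := by
  have h := (Pi.basisFun k (Fin 2)).constr_basis k (V31Alg.gen k) i
  rw [Pi.basisFun_apply] at h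
  rw [toPres, TensorAlgebra.lift_ι_apply]
  exact h

theorem toPres_surjective : Function.Surjective (toPres k) := by
  intro z
  induction z using V31Alg.induction_mul with
  | hone => exact ⟨1, map_one _⟩
  | hadd s t hs ht =>
    obtain ⟨s, rfl⟩ := hs
    obtain ⟨t, rfl⟩ := ht
    exact ⟨s + t, map_add _ _ _⟩
  | hsmul r t ht =>
    obtain ⟨t, rfl⟩ := ht
    exact ⟨r • t, map_smul _ _ _⟩
  | hmul i t ht =>
    obtain ⟨t, rfl⟩ := ht
    exact ⟨TensorAlgebra.ι k (e i) * t, by rw [map_mul, toPres_ι]⟩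

variable (k) in
/-- The two-sided ideal of `T(V₃₁)` generated by the defining relations of the presented algebra. -/
def relIdeal : TwoSidedIdeal (TensorAlgebra k (Fin 2 → k)) :=
  let x := TensorAlgebra.ι k (e (0 : Fin 2))
  let y := TensorAlgebra.ι k (e (1 : Fin 2))
  TwoSidedIdeal.span {x * x - (2 : k) • (y * y), x * y + y * x, y ^ 4}

theorem relIdeal_homogeneous : ∃ S : Set (TensorAlgebra k (Fin 2 → k)),
    (∀ s ∈ S, ∃ n : ℕ, 2 ≤ n ∧
      s ∈ LinearMap.range (TensorAlgebra.ι k (M := Fin 2 → k)) ^ n) ∧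
    relIdeal k = TwoSidedIdeal.span S := by
  refine ⟨_, ?_, rfl⟩
  have h : ∀ i, TensorAlgebra.ι k (e i) ∈ LinearMap.range (TensorAlgebra.ι k (M := Fin 2 → k)) :=
    fun i => ⟨e i, rfl⟩
  rintro s (rfl | rfl | rfl)
  · refine ⟨2, le_rfl, ?_⟩
    rw [pow_two]
    exact Submodule.sub_mem _ (Submodule.mul_mem_mul (h 0) (h 0))
      (Submodule.smul_mem _ _ (Submodule.mul_mem_mul (h 1) (h 1)))
  · refine ⟨2, le_rfl, ?_⟩
    rw [pow_two]
    exact Submodule.add_mem _ (Submodule.mul_mem_mul (h 0) (h 1))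
      (Submodule.mul_mem_mul (h 1) (h 0))
  · exact ⟨4, by norm_num, Submodule.pow_mem_pow _ (h 1) 4⟩

theorem mem_relIdeal_iff (t : TensorAlgebra k (Fin 2 → k)) :
    t ∈ relIdeal k ↔ toPres k t = 0 := by
  constructor
  · intro ht
    have h : relIdeal k ≤ TwoSidedIdeal.ker (toPres k) := by
      rw [relIdeal, TwoSidedIdeal.span_le]
      rintro s (rfl | rfl | rfl) <;> rw [SetLike.mem_coe, TwoSidedIdeal.mem_ker]
      · simp [toPres_ι, V31Alg.xx]
      · simp [toPres_ι, V31Alg.yx]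
      · simpa [toPres_ι, pow_succ, mul_assoc] using V31Alg.yyyy k
    exact (TwoSidedIdeal.mem_ker _).1 (h ht)
  · intro ht
    let q := (relIdeal k).ringCon.mkₐ k
    have hq : ∀ t, q t = 0 ↔ t ∈ relIdeal k := by
      intro t
      conv_rhs => rw [← TwoSidedIdeal.ker_ringCon_mk' (relIdeal k), TwoSidedIdeal.mem_ker]
      rfl
    -- The quotient by the relation ideal satisfies the relations, so its projection factors through
    -- `toPres`.
    let ψ : V31Alg k →ₐ[k] (relIdeal k).ringCon.Quotient :=
      V31Alg.lift (fun i => q (TensorAlgebra.ι k (e i)))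
        (by
          rw [← sub_eq_zero, ← map_mul q, ← map_mul q, ← map_smul q, ← map_sub q, hq]
          exact TwoSidedIdeal.subset_span (by simp))
        (by
          rw [eq_neg_iff_add_eq_zero, add_comm, ← map_mul q, ← map_mul q, ← map_add q, hq]
          exact TwoSidedIdeal.subset_span (by simp))
        (by
          rw [← map_mul q, ← map_mul q, hq]
          exact TwoSidedIdeal.subset_span (by simp [pow_succ, mul_assoc]))
    have hψ : ∀ t, ψ (toPres k t) = q t := by
      intro t
      induction t using tensor_induction with
      | hone => simp only [map_one]
      | hadd s t hs ht => simp only [map_add, hs, ht]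
      | hsmul r t ht => simp only [map_smul, ht]
      | hmul i t ht => rw [map_mul, map_mul, map_mul, ht, toPres_ι, V31Alg.lift_gen]
    rw [← hq, ← hψ, ht, map_zero]

variable {ξ : k} (hξ : IsPrimitiveRoot ξ 4)

theorem toPres_tensorAct (i : KGen) (t : TensorAlgebra k (Fin 2 → k)) :
    toPres k ((V31 hξ).tensorAct (gen hξ i) t) = V31Alg.op hξ i (toPres k t) := by
  -- The comultiplication of one generator of 𝒦 involves others, so the hypothesis is needed for all
  -- of them.
  induction t using tensor_induction generalizing i with
  | hone => rw [(V31 hξ).tensorAct_one, AlgHom.commutes, map_one, V31Alg.op_one, counit_gen]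
  | hadd s t hs ht => simp only [map_add, hs, ht]
  | hsmul r t ht => simp only [map_smul, ht]
  | hmul j t ht =>
    have hact : ∀ i j, (V31 hξ).act (gen hξ i) (e j) =
      V31Mat ξ i 0 j • e 0 + V31Mat ξ i 1 j • e 1 := V31Act_gen_e hξ
    rw [(V31 hξ).tensorAct_ι_mul, comul_gen, map_mul, toPres_ι]
    fin_cases j <;> cases i <;>
      simp [comulGen, hact, V31Mat, ht, toPres_ι, V31Alg.a_x, V31Alg.b_x, V31Alg.c_x, V31Alg.d_x,
        V31Alg.a_y, V31Alg.b_y, V31Alg.c_y, V31Alg.d_y] <;> abel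

theorem map_toPres_braidedMul (i : Fin 2)
    (c : TensorAlgebra k (Fin 2 → k) ⊗[k] TensorAlgebra k (Fin 2 → k)) :
    TensorProduct.map (toPres k).toLinearMap (toPres k).toLinearMap
        ((V31 hξ).braidedMul (TensorAlgebra.ι k (e i) ⊗ₜ 1 + 1 ⊗ₜ TensorAlgebra.ι k (e i)) c) =
      V31Alg.braidGen hξ i
        (TensorProduct.map (toPres k).toLinearMap (toPres k).toLinearMap c) := by
  induction c using TensorProduct.induction_on with
  | zero => simp only [map_zero]
  | add s t hs ht =>
    rw [map_add, map_add, hs, ht, map_add, map_add]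
  | tmul z w =>
    have h0 : (V31 hξ).coact (e 0) = _ := V31Coact_zero hξ
    have h1 : (V31 hξ).coact (e 1) = _ := V31Coact_one hξ
    rw [map_add, LinearMap.add_apply, (V31 hξ).braidedMul_tmul_one, (V31 hξ).braidedMul_tmul,
      (V31 hξ).tensorCoact_ι]
    fin_cases i
    · simp [h0, toPres_ι, toPres_tensorAct, V31Alg.braidGen_zero, add_assoc]
    · simp [h1, toPres_ι, toPres_tensorAct, V31Alg.braidGen_one, add_sub_assoc]

/-- Both sides take the same value at 1 and obey the same recursion under left multiplication by a
generator. -/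
theorem map_toPres_tensorComul (t : TensorAlgebra k (Fin 2 → k)) :
    TensorProduct.map (toPres k).toLinearMap (toPres k).toLinearMap ((V31 hξ).tensorComul t) =
      V31Alg.braid hξ (toPres k t) (1 ⊗ₜ 1) := by
  induction t using tensor_induction with
  | hone => simp [(V31 hξ).tensorComul_one]
  | hadd s t hs ht => simp only [map_add, hs, ht, LinearMap.add_apply]
  | hsmul r t ht => simp only [map_smul, ht, LinearMap.smul_apply]
  | hmul i t ht =>
    rw [(V31 hξ).tensorComul_ι_mul, map_toPres_braidedMul, ht, map_mul, map_mul, toPres_ι,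
      V31Alg.braid_gen, Module.End.mul_apply]

theorem relIdeal_mem_nicholsIdeals : relIdeal k ∈ (V31 hξ).nicholsIdeals := by
  refine ⟨relIdeal_homogeneous, fun t ht => ?_⟩
  have h : (V31 hξ).tensorComul t ∈ LinearMap.ker
      (TensorProduct.map (toPres k).toLinearMap (toPres k).toLinearMap) := by
    rw [LinearMap.mem_ker, map_toPres_tensorComul, (mem_relIdeal_iff t).1 ht, map_zero,
      LinearMap.zero_apply]
  -- For surjective π, right exactness gives ker(π ⊗ π) = T(V) ⊗ ker π + ker π ⊗ T(V).
  have hex := LinearMap.exact_subtype_ker_map (toPres k).toLinearMap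
  have hsurj : Function.Surjective (toPres k).toLinearMap := toPres_surjective
  rw [TensorProduct.map_ker hex hsurj hex hsurj] at h
  refine SetLike.le_def.1 (sup_le ?_ ?_) h
  · rintro _ ⟨c, rfl⟩
    induction c using TensorProduct.induction_on with
    | zero => simp
    | add x y hx hy => rw [map_add]; exact Submodule.add_mem _ hx hy
    | tmul x y =>
      exact Submodule.subset_span ⟨y, (mem_relIdeal_iff _).2 y.2, x, Or.inr rfl⟩
  · rintro _ ⟨c, rfl⟩
    induction c using TensorProduct.induction_on with
    | zero => simp
    | add x y hx hy => rw [map_add]; exact Submodule.add_mem _ hx hy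
    | tmul x y =>
      exact Submodule.subset_span ⟨x, (mem_relIdeal_iff _).2 x.2, y, Or.inl rfl⟩

/-! ### Skew derivations detect xy³ -/

/-- The skew derivations of `T(V₃₁)` given by the coordinates of `V₃₁`. -/
def der (i : Fin 2) : TensorAlgebra k (Fin 2 → k) →ₗ[k] TensorAlgebra k (Fin 2 → k) :=
  (V31 hξ).skewDer (LinearMap.proj i)

/-- A coordinate form composed with the action is a row of the action matrix, so the twisted Leibniz
rule closes up on the two coordinate derivations. -/
theorem skewDer_proj_comp_act (i : KGen) (j : Fin 2) (t : TensorAlgebra k (Fin 2 → k)) :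
    (V31 hξ).skewDer (LinearMap.proj j ∘ₗ (V31 hξ).act (gen hξ i)) t =
      V31Mat ξ i j 0 • der hξ 0 t + V31Mat ξ i j 1 • der hξ 1 t := by
  have h : LinearMap.proj j ∘ₗ (V31 hξ).act (gen hξ i) =
      V31Mat ξ i j 0 • (LinearMap.proj 0 : (Fin 2 → k) →ₗ[k] k) +
        V31Mat ξ i j 1 • LinearMap.proj 1 := by
    have hact : (V31 hξ).act (gen hξ i) = Matrix.toLinAlgEquiv' (V31Mat ξ i) := V31Act_gen hξ i
    ext l
    fin_cases l <;> fin_cases j <;> simp [hact]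
  simp [h, der, YetterDrinfeldModule.skewDer, LinearMap.add_comp, LinearMap.smul_comp,
    LinearMap.rTensor_add, LinearMap.rTensor_smul]

theorem der_x (j : Fin 2) (t : TensorAlgebra k (Fin 2 → k)) :
    der hξ j (TensorAlgebra.ι k (e 0) * t) = e (k := k) 0 j • t +
      (TensorAlgebra.ι k (e 0) * (V31Mat ξ .d j 0 • der hξ 0 t + V31Mat ξ .d j 1 • der hξ 1 t) +
      (ξ - 1) • (TensorAlgebra.ι k (e 1) *
        (V31Mat ξ .c j 0 • der hξ 0 t + V31Mat ξ .c j 1 • der hξ 1 t))) := by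
  have h : (V31 hξ).coact (e 0) =
      ∑ i ∈ Finset.univ, ![gen hξ .d, gen hξ .c] i ⊗ₜ[k] ![e (0 : Fin 2), (ξ - 1) • e 1] i := by
    rw [Fin.sum_univ_two]
    refine (V31Coact_zero hξ).trans ?_
    simp [TensorProduct.smul_tmul']
  rw [der, (V31 hξ).skewDer_ι_mul _ h]
  simp [skewDer_proj_comp_act]

theorem der_y (j : Fin 2) (t : TensorAlgebra k (Fin 2 → k)) :
    der hξ j (TensorAlgebra.ι k (e 1) * t) = e (k := k) 1 j • t +
      (TensorAlgebra.ι k (e 1) * (V31Mat ξ .a j 0 • der hξ 0 t + V31Mat ξ .a j 1 • der hξ 1 t) +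
      (-(2⁻¹ * (1 + ξ))) • (TensorAlgebra.ι k (e 0) *
        (V31Mat ξ .b j 0 • der hξ 0 t + V31Mat ξ .b j 1 • der hξ 1 t))) := by
  have h : (V31 hξ).coact (e 1) = ∑ i ∈ Finset.univ, ![gen hξ .a, gen hξ .b] i ⊗ₜ[k]
      ![e (1 : Fin 2), (-(2⁻¹ * (1 + ξ))) • e 0] i := by
    rw [Fin.sum_univ_two]
    refine (V31Coact_one hξ).trans ?_
    simp [sub_eq_add_neg, TensorProduct.tmul_neg]
  rw [der, (V31 hξ).skewDer_ι_mul _ h]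
  simp [skewDer_proj_comp_act]

theorem der_zero_x (t : TensorAlgebra k (Fin 2 → k)) :
    der hξ 0 (TensorAlgebra.ι k (e 0) * t) = t + ξ • (TensorAlgebra.ι k (e 0) * der hξ 0 t) +
      (ξ - 1) • (TensorAlgebra.ι k (e 1) * der hξ 1 t) := by
  have h : (e 0 : Fin 2 → k) 0 = 1 := by simp [e]
  simp [der_x, V31Mat, h, add_assoc]

theorem der_one_x (t : TensorAlgebra k (Fin 2 → k)) :
    der hξ 1 (TensorAlgebra.ι k (e 0) * t) = -(TensorAlgebra.ι k (e 0) * der hξ 1 t) := by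
  have h : (e 0 : Fin 2 → k) 1 = 0 := by simp [e]
  simp [der_x, V31Mat, h]

theorem der_zero_y (t : TensorAlgebra k (Fin 2 → k)) :
    der hξ 0 (TensorAlgebra.ι k (e 1) * t) = -ξ • (TensorAlgebra.ι k (e 1) * der hξ 0 t) +
      (2⁻¹ * (1 + ξ)) • (TensorAlgebra.ι k (e 0) * der hξ 1 t) := by
  have h : (e 1 : Fin 2 → k) 0 = 0 := by simp [e]
  simp [der_y, V31Mat, h]

theorem der_one_y (t : TensorAlgebra k (Fin 2 → k)) :
    der hξ 1 (TensorAlgebra.ι k (e 1) * t) = t - TensorAlgebra.ι k (e 1) * der hξ 1 t := by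
  have h : (e 1 : Fin 2 → k) 1 = 1 := by simp [e]
  simp [der_y, V31Mat, h, sub_eq_add_neg]

theorem der_apply_one (j : Fin 2) : der hξ j 1 = 0 := (V31 hξ).skewDer_one _

/-- The successive values, computed in T(V) itself, are -xy², then -y² + ½(1 - ξ)x², then ½(1 - ξ)x,
then ½(1 - ξ). -/
theorem der_socle : der hξ 0 (der hξ 0 (der hξ 0 (der hξ 1 (TensorAlgebra.ι k (e 0) *
    (TensorAlgebra.ι k (e 1) * (TensorAlgebra.ι k (e 1) * TensorAlgebra.ι k (e 1))))))) =
      algebraMap k _ (2⁻¹ * (1 - ξ)) := by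
  have h2 := xi_sq hξ
  have h3 := two_ne_zero hξ
  have hx : ∀ j, der hξ j (TensorAlgebra.ι k (e 0)) = (e (k := k) 0 j) • 1 := by
    intro j
    simpa [der_apply_one] using der_x hξ j 1
  have hy : ∀ j, der hξ j (TensorAlgebra.ι k (e 1)) = (e (k := k) 1 j) • 1 := by
    intro j
    simpa [der_apply_one] using der_y hξ j 1
  have h00 : (e 0 : Fin 2 → k) 0 = 1 := by simp [e]
  have h01 : (e 0 : Fin 2 → k) 1 = 0 := by simp [e]
  have h10 : (e 1 : Fin 2 → k) 0 = 0 := by simp [e]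
  have h11 : (e 1 : Fin 2 → k) 1 = 1 := by simp [e]
  simp only [der_one_x, der_one_y, hy, h11, one_smul, mul_one, sub_self, mul_zero, sub_zero,
    map_neg, der_zero_x, der_zero_y, h10, zero_smul, smul_zero, zero_add, add_zero, mul_smul_comm,
    map_add, map_smul, hx, h00, Algebra.algebraMap_eq_smul_one]
  match_scalars
  grind

/-- A multiple of `xy³` which lies in the ideal of the Nichols algebra is zero. -/
theorem eq_zero_of_smul_socle_mem {r : k}
    (hr : r • (TensorAlgebra.ι k (e 0) * (TensorAlgebra.ι k (e 1) *
      (TensorAlgebra.ι k (e 1) * TensorAlgebra.ι k (e 1)))) ∈ (V31 hξ).nicholsIdeal) : r = 0 := by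
  have hN := (V31 hξ).nicholsIdeal_isGreatest.1
  have h := (V31 hξ).skewDer_mem hN (LinearMap.proj 0) <|
    (V31 hξ).skewDer_mem hN (LinearMap.proj 0) <|
    (V31 hξ).skewDer_mem hN (LinearMap.proj 0) <|
    (V31 hξ).skewDer_mem hN (LinearMap.proj 1) hr
  change der hξ 0 (der hξ 0 (der hξ 0 (der hξ 1 _))) ∈ _ at h
  simp only [map_smul, der_socle] at h
  have h0 := ((V31 hξ).algebraMapInv_and_ιInv_eq_zero_of_mem hN h).1
  have h2 := xi_sq hξ
  have h3 := two_ne_zero hξ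
  rw [map_smul, AlgHom.commutes, Algebra.algebraMap_self_apply, smul_eq_mul] at h0
  -- The scalar is nonzero because (1 - ξ)(1 + ξ) = 2.
  grind

end HopfK

/-! ### Monomial basis and the Nichols ideal -/

namespace V31Alg

variable (k : Type u) [Field k]

/-- The monomials `yⁱ` and `xyⁱ` for `i < 4`. -/
def monomials : Fin 8 → V31Alg k :=
  ![1, gen k 1, gen k 1 * gen k 1, gen k 1 * (gen k 1 * gen k 1),
    gen k 0, gen k 0 * gen k 1, gen k 0 * (gen k 1 * gen k 1),
    gen k 0 * (gen k 1 * (gen k 1 * gen k 1))]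

/-- The span contains 1 and is stable under left multiplication by x and y: x·xyⁱ = 2yⁱ⁺² and y·xyⁱ
= -xyⁱ⁺¹, with y⁴ = 0. -/
theorem span_monomials : Submodule.span k (Set.range (monomials k)) = ⊤ := by
  have hm : ∀ i, monomials k i ∈ Submodule.span k (Set.range (monomials k)) :=
    fun i => Submodule.subset_span ⟨i, rfl⟩
  rw [eq_top_iff]
  rintro z -
  induction z using induction_mul with
  | hone => exact hm 0
  | hadd s t hs ht => exact Submodule.add_mem _ hs ht
  | hsmul r t ht => exact Submodule.smul_mem _ r ht
  | hmul i t ht =>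
    induction ht using Submodule.span_induction with
    | zero => simp
    | add s t _ _ hs ht => rw [mul_add]; exact Submodule.add_mem _ hs ht
    | smul r t _ ht => rw [mul_smul_comm]; exact Submodule.smul_mem _ r ht
    | mem t ht =>
      obtain ⟨j, rfl⟩ := ht
      generalize Submodule.span k (Set.range (monomials k)) = W at hm ⊢
      have h1 := hm 1
      have h2 := hm 2
      have h3 := hm 3
      have h4 := hm 4
      have h5 := hm 5
      have h6 := hm 6
      have h7 := hm 7
      simp only [monomials, Matrix.cons_val] at h1 h2 h3 h4 h5 h6 h7
      fin_cases i <;> fin_cases j <;>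
        simp [monomials, xx, yx, xx_mul, yx_mul, yyyy] <;>
        first | assumption | exact W.smul_mem _ ‹_›

end V31Alg

namespace HopfK

variable {k : Type u} [Field k] {ξ : k} (hξ : IsPrimitiveRoot ξ 4)

/-- A linear combination of the monomials `yⁱ`, `xyⁱ` with a preimage in the ideal of the Nichols
algebra is trivial. -/
theorem eq_zero_of_sum_monomials {g : Fin 8 → k} {t : TensorAlgebra k (Fin 2 → k)}
    (ht : t ∈ (V31 hξ).nicholsIdeal) (hg : toPres k t = ∑ i, g i • V31Alg.monomials k i) :
    g = 0 := by
  have hsocle : ∀ s ∈ (V31 hξ).nicholsIdeal, ∀ r : k,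
      toPres k s = r • (V31Alg.gen k 0 * (V31Alg.gen k 1 * (V31Alg.gen k 1 * V31Alg.gen k 1))) →
        r = 0 := by
    intro s hs r hr
    apply eq_zero_of_smul_socle_mem hξ
    -- The difference of s and the multiple of xy³ maps to 0 in the presented algebra, so it lies in
    -- the relation ideal and hence in the Nichols ideal.
    rw [← sub_sub_cancel s (r • _)]
    refine (V31 hξ).nicholsIdeal.sub_mem hs ?_
    refine (V31 hξ).nicholsIdeal_isGreatest.2 (relIdeal_mem_nicholsIdeals hξ) ?_
    rw [mem_relIdeal_iff]
    simp [hr, toPres_ι]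
  have hmul : ∀ (p) (r : k), toPres k p * (∑ i, g i • V31Alg.monomials k i) =
      r • (V31Alg.gen k 0 * (V31Alg.gen k 1 * (V31Alg.gen k 1 * V31Alg.gen k 1))) → r = 0 := by
    intro p r h
    refine hsocle _ ((V31 hξ).nicholsIdeal.mul_mem_left p t ht) r ?_
    rw [map_mul, hg, h]
  have hx : toPres k (TensorAlgebra.ι k (e 0)) = V31Alg.gen k 0 := toPres_ι 0
  have hy : toPres k (TensorAlgebra.ι k (e 1)) = V31Alg.gen k 1 := toPres_ι 1
  set x := TensorAlgebra.ι k (e (k := k) 0)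
  set y := TensorAlgebra.ι k (e (k := k) 1)
  -- Coefficients are removed by increasing degree of the monomial. The multiplier has complementary
  -- degree 4 minus that degree: it sends its own monomial to ±xy³, annihilates the other monomial
  -- of that degree, and pushes all higher ones past the top degree 4. The minus signs come from
  -- moving an odd power of y past x.
  have h0 : g 0 = 0 := hmul (x * (y * (y * y))) (g 0) (by
    simp [hx, hy, V31Alg.monomials, Fin.sum_univ_eight, mul_add, mul_assoc, V31Alg.xx_mul,
      V31Alg.yx_mul, V31Alg.yyyy, V31Alg.yx])
  have h4 : -g 4 = 0 := hmul (y * (y * y)) (-g 4) (by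
    simp [hy, V31Alg.monomials, Fin.sum_univ_eight, mul_add, mul_assoc,
      V31Alg.yx_mul, V31Alg.yyyy, V31Alg.yx, h0])
  rw [neg_eq_zero] at h4
  have h1 : g 1 = 0 := hmul (x * (y * y)) (g 1) (by
    simp [hx, hy, V31Alg.monomials, Fin.sum_univ_eight, mul_add, mul_assoc, V31Alg.xx_mul,
      V31Alg.yx_mul, V31Alg.yyyy, h0, h4])
  have h5 : g 5 = 0 := hmul (y * y) (g 5) (by
    simp [hy, V31Alg.monomials, Fin.sum_univ_eight, mul_add, mul_assoc,
      V31Alg.yx_mul, V31Alg.yyyy, h0, h4, h1])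
  have h2 : g 2 = 0 := hmul (x * y) (g 2) (by
    simp [hx, hy, V31Alg.monomials, Fin.sum_univ_eight, mul_add, mul_assoc, V31Alg.xx_mul,
      V31Alg.yx_mul, V31Alg.yyyy, h0, h4, h1, h5])
  have h6 : -g 6 = 0 := hmul y (-g 6) (by
    simp [hy, V31Alg.monomials, Fin.sum_univ_eight, mul_add,
      V31Alg.yx_mul, V31Alg.yyyy, h0, h4, h1, h5, h2])
  rw [neg_eq_zero] at h6
  have h3 : g 3 = 0 := hmul x (g 3) (by
    simp [hx, V31Alg.monomials, Fin.sum_univ_eight, mul_add, V31Alg.xx_mul,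
      V31Alg.yyyy, h0, h4, h1, h5, h2, h6])
  have h7 : g 7 = 0 := hmul 1 (g 7) (by
    simp [V31Alg.monomials, Fin.sum_univ_eight, h0, h4, h1, h5, h2, h6, h3])
  ext i
  fin_cases i <;> assumption

theorem mem_nicholsIdeal_iff (t : TensorAlgebra k (Fin 2 → k)) :
    t ∈ (V31 hξ).nicholsIdeal ↔ toPres k t = 0 := by
  constructor
  · intro ht
    have h : toPres k t ∈ Submodule.span k (Set.range (V31Alg.monomials k)) := by
      rw [V31Alg.span_monomials]
      exact Submodule.mem_top
    obtain ⟨g, hg⟩ := (Submodule.mem_span_range_iff_exists_fun k).1 h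
    rw [← hg, eq_zero_of_sum_monomials hξ ht hg.symm]
    simp
  · intro ht
    exact (V31 hξ).nicholsIdeal_isGreatest.2 (relIdeal_mem_nicholsIdeals hξ)
      ((mem_relIdeal_iff t).2 ht)

theorem finrank_V31Alg {ξ : k} (hξ : IsPrimitiveRoot ξ 4) : Module.finrank k (V31Alg k) = 8 := by
  have hli : LinearIndependent k (V31Alg.monomials k) := by
    rw [Fintype.linearIndependent_iff]
    intro g hg i
    -- A linear relation between the monomials is a combination with preimage 0, which lies in the
    -- Nichols ideal.
    rw [eq_zero_of_sum_monomials hξ (g := g) (t := 0) (V31 hξ).nicholsIdeal.zero_mem (by simp [hg])]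
    rfl
  have h := Module.finrank_eq_card_basis (Module.Basis.mk hli (V31Alg.span_monomials k).ge)
  simpa using h

/-! ### The isomorphism -/

/-- The canonical map from the tensor algebra to the Nichols algebra. -/
def nicholsMk : TensorAlgebra k (Fin 2 → k) →ₐ[k] (V31 hξ).NicholsAlgebra :=
  (V31 hξ).nicholsIdeal.ringCon.mkₐ k

theorem nicholsMk_eq_zero_iff (t : TensorAlgebra k (Fin 2 → k)) :
    nicholsMk hξ t = 0 ↔ toPres k t = 0 := by
  rw [← mem_nicholsIdeal_iff hξ]
  conv_rhs => rw [← TwoSidedIdeal.ker_ringCon_mk' (V31 hξ).nicholsIdeal, TwoSidedIdeal.mem_ker]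
  rfl

/-- The algebra map from the presented algebra to the Nichols algebra. -/
def presToNichols : V31Alg k →ₐ[k] (V31 hξ).NicholsAlgebra :=
  V31Alg.lift (fun i => nicholsMk hξ (TensorAlgebra.ι k (e i)))
    (by
      rw [← sub_eq_zero, ← map_mul (nicholsMk hξ), ← map_mul (nicholsMk hξ),
        ← map_smul (nicholsMk hξ), ← map_sub (nicholsMk hξ), nicholsMk_eq_zero_iff]
      simp [toPres_ι, V31Alg.xx])
    (by
      rw [eq_neg_iff_add_eq_zero, ← map_mul (nicholsMk hξ), ← map_mul (nicholsMk hξ),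
        ← map_add (nicholsMk hξ), nicholsMk_eq_zero_iff]
      simp [toPres_ι, V31Alg.yx])
    (by
      rw [← map_mul (nicholsMk hξ), ← map_mul (nicholsMk hξ), nicholsMk_eq_zero_iff]
      simp [toPres_ι, V31Alg.yyyy, mul_assoc])

theorem presToNichols_gen (i : Fin 2) :
    presToNichols hξ (V31Alg.gen k i) = (V31 hξ).nicholsι (e i) :=
  V31Alg.lift_gen _ _ _ _ i

theorem presToNichols_toPres (t : TensorAlgebra k (Fin 2 → k)) :
    presToNichols hξ (toPres k t) = nicholsMk hξ t := by
  induction t using tensor_induction with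
  | hone => simp only [map_one]
  | hadd s t hs ht => simp only [map_add, hs, ht]
  | hsmul r t ht => simp only [map_smul, ht]
  | hmul i t ht =>
    rw [map_mul, map_mul, map_mul, ht, toPres_ι, presToNichols_gen]
    rfl

/-- Both algebras are quotients of T(V) by the same kernel, and the map is compatible with the two
projections. -/
theorem presToNichols_bijective : Function.Bijective (presToNichols hξ) := by
  constructor
  · rw [injective_iff_map_eq_zero]
    intro z hz
    obtain ⟨t, rfl⟩ := toPres_surjective z
    rwa [presToNichols_toPres, nicholsMk_eq_zero_iff] at hz
  · intro z
    obtain ⟨t, rfl⟩ := RingCon.mk'_surjective _ z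
    exact ⟨toPres k t, presToNichols_toPres hξ t⟩

/-- The isomorphism from the presented algebra to the Nichols algebra. -/
def presEquivNichols : V31Alg k ≃ₐ[k] (V31 hξ).NicholsAlgebra :=
  AlgEquiv.ofBijective (presToNichols hξ) (presToNichols_bijective hξ)

end HopfK

end

theorem mainTheorem9 {k : Type*} [Field k] [IsAlgClosed k] [CharZero k] {ξ : k}
    (hξ : IsPrimitiveRoot ξ 4) :
    (∃ φ : RingQuot (V31Rel k) ≃ₐ[k] (HopfK.V31 hξ).NicholsAlgebra,
      φ (RingQuot.mkAlgHom k (V31Rel k) (FreeAlgebra.ι k 0)) =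
          (HopfK.V31 hξ).nicholsι (HopfK.e 0) ∧
        φ (RingQuot.mkAlgHom k (V31Rel k) (FreeAlgebra.ι k 1)) =
          (HopfK.V31 hξ).nicholsι (HopfK.e 1)) ∧
      Module.finrank k (HopfK.V31 hξ).NicholsAlgebra = 8 :=
  ⟨⟨HopfK.presEquivNichols hξ, HopfK.presToNichols_gen hξ 0, HopfK.presToNichols_gen hξ 1⟩,
    (HopfK.presEquivNichols hξ).toLinearEquiv.finrank_eq.symm.trans (HopfK.finrank_V31Alg hξ)⟩
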